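/- **Languages.** Let $\Phi$ (primitive propositions) and $\mathcal X$ (variables) be countably infinite sets and let $1,\dots,n$ be agents. $\mathcal L^{\forall,K,X,A}_n(\Phi,\mathcal X)$ is the set of formulas built from $\Phi\cup\mathcal X$ with $\neg$, $\wedge$, $K_i$, $A_i$, $X_i$ ($1\le i\le n$) and $\forall x$ ($x\in\mathcal X$); $\vee$, $\Rightarrow$, $\Leftrightarrow$ are the usual abbreviations. $\mathcal L^{\forall,K}_n(\Phi,\mathcal X)$ consists of the formulas without $A_i$, $X_i$; $\mathcal L^{K,X,A}_n(\Phi)$ and $\mathcal L^{K}_n(\Phi)$ consist of the formulas of these two languages, respectively, that contain no quantifiers and no variables. A sentence is a formula without free variables, and $\Phi(\varphi)$ is the set of primitive propositions occurring in $\varphi$. Write $A_i^*\varphi$ for $K_i(\varphi\vee\neg\varphi)$. An empty conjunction is *true*, e.g. $\forall x(x\vee\neg x)$. **Structures.** An extended awareness structure $M=(S,L,\pi,\mathcal K_1,\dots,\mathcal K_n,\mathcal A_1,\dots,\mathcal A_n)$ consists of a set $S$ of worlds, a map $L$ from $S$ to nonempty subsets of $\Phi$, an interpretation $\pi:S\times\Phi\to\{\mathbf{true},\mathbf{false}\}$,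 binary relations $\mathcal K_i$ on $S$, and sets $\mathcal A_i(s)$ of sentences of $\mathcal L^{\forall,K,X,A}_n(L(s),\mathcal X)$. $\mathcal N_n^{r,t,e}$ is the class of those structures in which every $\mathcal K_i$ is reflexive, transitive and Euclidean, a sentence $\varphi$ is in $\mathcal A_i(s)$ iff $\Phi(\varphi)\subseteq\mathcal A_i(s)$, and $(s,t)\in\mathcal K_i$ implies $\mathcal A_i(s)=\mathcal A_i(t)$. A sentence $\varphi$ can be true at $s$ only if $\Phi(\varphi)\subseteq L(s)$. Under this proviso: $p\in\Phi$ is true at $s$ iff $\pi(s,p)=\mathbf{true}$; $\neg\varphi$ iff $\varphi$ is not true at $s$; $\varphi\wedge\psi$ iff both are; $K_i\varphi$ iff $\varphi$ is true at all $t$ with $(s,t)\in\mathcal K_i$; $A_i\varphi$ iff $\varphi\in\mathcal A_i(s)$; $X_i\varphi$ iff $A_i\varphi$ and $K_i\varphi$ are true at $s$; $\forall x\varphi$ iff $\varphi[x/\psi]$ is true at $s$ for all $\psi\in\mathcal L^{K,X,A}_n(L(s))$. For the languages without $A_i$, $X_i$ the quantifier ranges over $\psi\in\mathcal L^{K}_n(L(s))$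 instead. $\varphi$ is valid in $\mathcal N_n^{r,t,e}$ if it is true at every world $s$ of every structure in the class with $\Phi(\varphi)\subseteq L(s)$. **Axioms and rules** (all instances are sentences of the language at hand). * Prop: all substitution instances of propositional tautologies. * K: $(K_i\varphi\wedge K_i(\varphi\Rightarrow\psi))\Rightarrow K_i\psi$. T: $K_i\varphi\Rightarrow\varphi$. 4: $K_i\varphi\Rightarrow K_iK_i\varphi$. * AGPP$^*$: $A_i^*\varphi\Leftrightarrow\bigwedge_{p\in\Phi(\varphi)}A_i^*p$. A0$^*$: $K_i\varphi\Rightarrow A_i^*\varphi$. 5$^*$: $(\neg K_i\varphi\wedge A_i^*\varphi)\Rightarrow K_i\neg K_i\varphi$. * $1_\forall$: $\forall x\varphi\Rightarrow\varphi[x/\psi]$ for $\psi$ a quantifier-free sentence. K$_\forall$: $\forall x(\varphi\Rightarrow\psi)\Rightarrow(\forall x\varphi\Rightarrow\forall x\psi)$. N$_\forall$: $\varphi\Rightarrow\forall x\varphi$ if $x$ is not free in $\varphi$. * Barcan$^*$: $(A_i^*(\forall x\varphi)\wedge\forall x(A_i^*x\Rightarrow K_i\varphi))\Rightarrow K_i(\forall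 xA_i^*x\Rightarrow\forall x\varphi)$. FA$^*$: $\forall x\neg A_i^*x\Rightarrow K_i\forall x\neg A_i^*x$. * AGPP: $A_i\varphi\Leftrightarrow\bigwedge_{p\in\Phi(\varphi)}A_ip$. KA: $A_i\varphi\Rightarrow K_iA_i\varphi$. A0: $X_i\varphi\Leftrightarrow K_i\varphi\wedge A_i\varphi$. * MP: from $\varphi$ and $\varphi\Rightarrow\psi$ infer $\psi$. Gen$^*$: from $\varphi$ infer $A_i^*\varphi\Rightarrow K_i\varphi$. Gen$_\forall$: for $q\in\Phi$, from $\varphi$ infer $\forall x\,\varphi[q/x]$, provided no occurrence of $q$ in $\varphi$ is in the scope of a quantifier $\forall x$. **Theorem.** With respect to $\mathcal N_n^{r,t,e}$, the following axiom systems are sound and complete (a sentence of the language is provable iff it is valid): (a) $\mathrm{AX}^{K,X,A,A^*,\forall}_e\cup\{\mathrm T,4,5^*\}=\{$Prop, AGPP, KA, A0, K, AGPP$^*$, A0$^*$, $1_\forall$, K$_\forall$, N$_\forall$, Barcan$^*$, FA$^*$, MP, Gen$^*$, Gen$_\forall$, T, 4, 5$^*\}$, for the sentences of $\mathcal L^{\forall,K,X,A}_n(\Phi,\mathcal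 X)$; (b) $\mathrm{AX}^{K,A^*,\forall}_e\cup\{\mathrm T,4,5^*\}=\{$Prop, K, AGPP$^*$, A0$^*$, $1_\forall$, K$_\forall$, N$_\forall$, Barcan$^*$, FA$^*$, MP, Gen$^*$, Gen$_\forall$, T, 4, 5$^*\}$, for the sentences of $\mathcal L^{\forall,K}_n(\Phi,\mathcal X)$; (c) $\mathrm{AX}^{K,A^*}_e\cup\{\mathrm T,4,5^*\}=\{$Prop, AGPP$^*$, K, A0$^*$, MP, Gen$^*$, T, 4, 5$^*\}$, for $\mathcal L^{K}_n(\Phi)$. -/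

import Mathlib

universe u

namespace Awareness

/-- Formulas over the agents `Fin n`, the primitive propositions `Φ` and the variables `V`.
`K i`, `A i`, `X i` are implicit knowledge, awareness and explicit knowledge of agent `i`. -/
inductive Formula (n : ℕ) (Φ V : Type u) : Type u
  | prim (p : Φ) : Formula n Φ V
  | var (x : V) : Formula n Φ V
  | neg (φ : Formula n Φ V) : Formula n Φ V
  | and (φ ψ : Formula n Φ V) : Formula n Φ V
  | K (i : Fin n) (φ : Formula n Φ V) : Formula n Φ V
  | A (i : Fin n) (φ : Formula n Φ V) : Formula n Φ V
  | X (i : Fin n) (φ : Formula n Φ V) : Formula n Φ V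
  | all (x : V) (φ : Formula n Φ V) : Formula n Φ V

namespace Formula

variable {n : ℕ} {Φ V : Type u}

/-! ### Abbreviations -/

/-- `φ ∨ ψ`, that is, `¬(¬φ ∧ ¬ψ)`. -/
def or (φ ψ : Formula n Φ V) : Formula n Φ V := neg (and (neg φ) (neg ψ))

/-- `φ ⇒ ψ`, that is, `¬φ ∨ ψ`. -/
def imp (φ ψ : Formula n Φ V) : Formula n Φ V := or (neg φ) ψ

/-- `φ ⇔ ψ`. -/
def iff (φ ψ : Formula n Φ V) : Formula n Φ V := and (imp φ ψ) (imp ψ φ)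

/-- `A_i^* φ`, that is, `K_i (φ ∨ ¬φ)`. -/
def Astar (i : Fin n) (φ : Formula n Φ V) : Formula n Φ V := K i (or φ (neg φ))

/-- The formula `∀ x (x ∨ ¬x)`, which mentions no primitive proposition; it serves as `true`. -/
def verum (x : V) : Formula n Φ V := all x (or (var x) (neg (var x)))

/-- The conjunction of a list of formulas; the empty conjunction is `true`, written with the
bound variable `x`. -/
def conj (x : V) : List (Formula n Φ V) → Formula n Φ V
  | [] => verum x
  | [φ] => φ
  | φ :: ψ :: l => and φ (conj x (ψ :: l))

/-! ### Syntactic notions -/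

/-- The set `Φ(φ)` of primitive propositions that occur in `φ`. -/
def prims : Formula n Φ V → Set Φ
  | prim p => {p}
  | var _ => ∅
  | neg φ => prims φ
  | and φ ψ => prims φ ∪ prims ψ
  | K _ φ => prims φ
  | A _ φ => prims φ
  | X _ φ => prims φ
  | all _ φ => prims φ

/-- The variables that are free in a formula. -/
def free : Formula n Φ V → Set V
  | prim _ => ∅
  | var x => {x}
  | neg φ => free φ
  | and φ ψ => free φ ∪ free ψ
  | K _ φ => free φ
  | A _ φ => free φ
  | X _ φ => free φ
  | all x φ => free φ \ {x}

/-- A sentence is a formula without free variables. -/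
def IsSentence (φ : Formula n Φ V) : Prop := φ.free = ∅

/-- The formula mentions neither quantification nor variables. -/
def QuantFree : Formula n Φ V → Prop
  | prim _ => True
  | var _ => False
  | neg φ => QuantFree φ
  | and φ ψ => QuantFree φ ∧ QuantFree ψ
  | K _ φ => QuantFree φ
  | A _ φ => QuantFree φ
  | X _ φ => QuantFree φ
  | all _ _ => False

/-- The formula mentions none of the operators `A i`, `X i`. -/
def KOnly : Formula n Φ V → Prop
  | prim _ => True
  | var _ => True
  | neg φ => KOnly φ
  | and φ ψ => KOnly φ ∧ KOnly ψ
  | K _ φ => KOnly φ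
  | A _ _ => False
  | X _ _ => False
  | all _ φ => KOnly φ

open Classical in
/-- `φ[x/ψ]`, written `φ.substVar x ψ`: replace all free occurrences of the variable `x` in `φ` by
`ψ`. Only used where `ψ` is a sentence, so that no variable can be captured. -/
noncomputable def substVar (φ : Formula n Φ V) (x : V) (ψ : Formula n Φ V) : Formula n Φ V :=
  match φ with
  | prim p => prim p
  | var y => if y = x then ψ else var y
  | neg φ => neg (φ.substVar x ψ)
  | and φ χ => and (φ.substVar x ψ) (χ.substVar x ψ)
  | K i φ => K i (φ.substVar x ψ)
  | A i φ => A i (φ.substVar x ψ)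
  | X i φ => X i (φ.substVar x ψ)
  | all y φ => if y = x then all y φ else all y (φ.substVar x ψ)

open Classical in
/-- `φ[q/ψ]`, written `φ.substPrim q ψ`: replace all occurrences of the primitive proposition `q`
in `φ` by `ψ`. -/
noncomputable def substPrim (φ : Formula n Φ V) (q : Φ) (ψ : Formula n Φ V) : Formula n Φ V :=
  match φ with
  | prim p => if p = q then ψ else prim p
  | var y => var y
  | neg φ => neg (φ.substPrim q ψ)
  | and φ χ => and (φ.substPrim q ψ) (χ.substPrim q ψ)
  | K i φ => K i (φ.substPrim q ψ)
  | A i φ => A i (φ.substPrim q ψ)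
  | X i φ => X i (φ.substPrim q ψ)
  | all y φ => all y (φ.substPrim q ψ)

/-- The variable `x` is substitutable for the primitive proposition `q` in a formula:
no occurrence of `q` lies in the scope of a quantifier `∀ x`. -/
def Substitutable (x : V) (q : Φ) : Formula n Φ V → Prop
  | prim _ => True
  | var _ => True
  | neg φ => Substitutable x q φ
  | and φ ψ => Substitutable x q φ ∧ Substitutable x q ψ
  | K _ φ => Substitutable x q φ
  | A _ φ => Substitutable x q φ
  | X _ φ => Substitutable x q φ
  | all y φ => (y = x → q ∉ φ.prims) ∧ Substitutable x q φ

/-- The number of quantifiers in a formula. -/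
def numAll : Formula n Φ V → ℕ
  | prim _ => 0
  | var _ => 0
  | neg φ => numAll φ
  | and φ ψ => numAll φ + numAll ψ
  | K _ φ => numAll φ
  | A _ φ => numAll φ
  | X _ φ => numAll φ
  | all _ φ => numAll φ + 1

theorem numAll_eq_zero {ψ : Formula n Φ V} (h : ψ.QuantFree) : ψ.numAll = 0 := by
  induction ψ with
  | prim | var => rfl
  | neg φ ih | K _ φ ih | A _ φ ih | X _ φ ih => exact ih h
  | and φ χ ih₁ ih₂ => simp [numAll, ih₁ h.1, ih₂ h.2]
  | all _ _ => exact h.elim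

theorem numAll_substVar (x : V) {ψ : Formula n Φ V} (h : ψ.QuantFree) (φ : Formula n Φ V) :
    (φ.substVar x ψ).numAll = φ.numAll := by
  induction φ with
  | prim => rfl
  | var y =>
    by_cases hy : y = x
    · simp [substVar, hy, numAll, numAll_eq_zero h]
    · simp [substVar, hy]
  | neg φ ih | K _ φ ih | A _ φ ih | X _ φ ih => simpa [substVar, numAll] using ih
  | and φ χ ih₁ ih₂ => simp [substVar, numAll, ih₁, ih₂]
  | all y φ ih => by_cases hy : y = x <;> simp [substVar, hy, numAll, ih]

end Formula

/-! ### Languages (sets of sentences) -/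

section Languages

variable (n : ℕ) (Φ V : Type u)

/-- The sentences of `L^{∀,K,X,A}_n(Φ,V)`. -/
def LAllKXA : Set (Formula n Φ V) := {φ | φ.IsSentence}

/-- The sentences of `L^{∀,K}_n(Φ,V)`. -/
def LAllK : Set (Formula n Φ V) := {φ | φ.IsSentence ∧ φ.KOnly}

/-- The language `L^{K,X,A}_n(Φ)`. -/
def LKXA : Set (Formula n Φ V) := {φ | φ.QuantFree}

/-- The language `L^K_n(Φ)`. -/
def LK : Set (Formula n Φ V) := {φ | φ.QuantFree ∧ φ.KOnly}

end Languages

/-! ### Extended awareness structures -/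

/-- An extended awareness structure for `n` agents over `Φ`. -/
structure ExtStructure (n : ℕ) (Φ V : Type u) where
  /-- The worlds. -/
  World : Type u
  /-- The primitive propositions of the language associated with each world. -/
  lang : World → Set Φ
  lang_nonempty : ∀ s, (lang s).Nonempty
  /-- The interpretation of the primitive propositions. -/
  val : World → Φ → Bool
  /-- The possibility relations. -/
  rel : Fin n → World → World → Prop
  /-- The sentences that each agent is aware of at each world. -/
  aware : Fin n → World → Set (Formula n Φ V)
  aware_sentence : ∀ i s, ∀ φ ∈ aware i s, φ.IsSentence
  aware_lang : ∀ i s, ∀ φ ∈ aware i s, φ.prims ⊆ lang s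

namespace ExtStructure

variable {n : ℕ} {Φ V : Type u}

/-- Truth at a world of the sentence `φ`, where the quantifiers range over those sentences of the
quantifier-free language `R` that belong to the language of the world. A sentence is true at a
world only if it belongs to the language of the world. (Variables that are free get the value
false; this is never used for sentences.) -/
def Sat (M : ExtStructure n Φ V) (R : Set (Formula n Φ V)) (s : M.World) :
    Formula n Φ V → Prop
  | .prim p => p ∈ M.lang s ∧ M.val s p = true
  | .var _ => False
  | .neg φ => φ.prims ⊆ M.lang s ∧ ¬ M.Sat R s φ
  | .and φ ψ => M.Sat R s φ ∧ M.Sat R s ψ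
  | .K i φ => φ.prims ⊆ M.lang s ∧ ∀ t, M.rel i s t → M.Sat R t φ
  | .A i φ => φ.prims ⊆ M.lang s ∧ φ ∈ M.aware i s
  | .X i φ => (φ.prims ⊆ M.lang s ∧ φ ∈ M.aware i s) ∧
      (φ.prims ⊆ M.lang s ∧ ∀ t, M.rel i s t → M.Sat R t φ)
  | .all x φ => φ.prims ⊆ M.lang s ∧
      ∀ ψ : Formula n Φ V, ψ.QuantFree → ψ ∈ R → ψ.prims ⊆ M.lang s →
        M.Sat R s (φ.substVar x ψ)
termination_by φ => (φ.numAll, sizeOf φ)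
decreasing_by
  all_goals simp only [Formula.numAll, Prod.lex_def]
  all_goals try rw [Formula.numAll_substVar _ ‹_›]
  all_goals simp
  all_goals omega

/-- Awareness is generated by primitive propositions. -/
def Agpp (M : ExtStructure n Φ V) : Prop :=
  ∀ i s (φ : Formula n Φ V), φ.IsSentence →
    (φ ∈ M.aware i s ↔ ∀ p ∈ φ.prims, Formula.prim p ∈ M.aware i s)

/-- Agents know what they are aware of. -/
def Ka (M : ExtStructure n Φ V) : Prop :=
  ∀ i s t, M.rel i s t → M.aware i s = M.aware i t

/-- Membership in the class `N_n^{r,t,e}`: awareness satisfies `agpp` and `ka`, and every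
possibility relation is reflexive, transitive and Euclidean. -/
structure IsNrte (M : ExtStructure n Φ V) : Prop where
  agpp : M.Agpp
  ka : M.Ka
  refl : ∀ i s, M.rel i s s
  trans : ∀ i s t u, M.rel i s t → M.rel i t u → M.rel i s u
  eucl : ∀ i s t u, M.rel i s t → M.rel i s u → M.rel i t u

end ExtStructure

/-- Validity in `N_n^{r,t,e}`: truth at all worlds whose language contains the sentence. The
quantifiers range over the quantifier-free language `R`. -/
def Valid {n : ℕ} {Φ V : Type u} (R : Set (Formula n Φ V)) (φ : Formula n Φ V) : Prop :=
  ∀ M : ExtStructure n Φ V, M.IsNrte → ∀ s : M.World, φ.prims ⊆ M.lang s → M.Sat R s φ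

/-! ### Axioms -/

/-- Formulas of propositional logic. -/
inductive PropForm : Type
  | atom (k : ℕ) : PropForm
  | neg (θ : PropForm) : PropForm
  | and (θ η : PropForm) : PropForm

namespace PropForm

/-- The truth value under an assignment to the atoms. -/
def eval (v : ℕ → Bool) : PropForm → Bool
  | atom k => v k
  | neg θ => !(eval v θ)
  | and θ η => eval v θ && eval v η

/-- The substitution instance given by `σ`. -/
def inst {n : ℕ} {Φ V : Type u} (σ : ℕ → Formula n Φ V) : PropForm → Formula n Φ V
  | atom k => σ k
  | neg θ => .neg (inst σ θ)
  | and θ η => .and (inst σ θ) (inst σ η)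

end PropForm

section Axioms

open Formula

variable (n : ℕ) (Φ V : Type u)

/-- Prop: substitution instances of valid formulas of propositional logic. -/
def axProp : Set (Formula n Φ V) :=
  {φ | ∃ (θ : PropForm) (σ : ℕ → Formula n Φ V), (∀ v, θ.eval v = true) ∧ φ = θ.inst σ}

/-- AGPP: `A_i φ ⇔ ⋀_{p ∈ Φ(φ)} A_i p`, for every enumeration of `Φ(φ)`. -/
def axAGPP : Set (Formula n Φ V) :=
  {χ | ∃ (i : Fin n) (φ : Formula n Φ V) (l : List Φ) (x : V),
    l.Nodup ∧ (∀ p, p ∈ l ↔ p ∈ φ.prims) ∧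
      χ = iff (A i φ) (conj x (l.map fun p => A i (prim p)))}

/-- KA: `A_i φ ⇒ K_i A_i φ`. -/
def axKA : Set (Formula n Φ V) :=
  {χ | ∃ (i : Fin n) (φ : Formula n Φ V), χ = imp (A i φ) (K i (A i φ))}

/-- A0: `X_i φ ⇔ K_i φ ∧ A_i φ`. -/
def axA0 : Set (Formula n Φ V) :=
  {χ | ∃ (i : Fin n) (φ : Formula n Φ V), χ = iff (X i φ) (and (K i φ) (A i φ))}

/-- K: `(K_i φ ∧ K_i (φ ⇒ ψ)) ⇒ K_i ψ`. -/
def axK : Set (Formula n Φ V) :=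
  {χ | ∃ (i : Fin n) (φ ψ : Formula n Φ V),
    χ = imp (and (K i φ) (K i (imp φ ψ))) (K i ψ)}

/-- T: `K_i φ ⇒ φ`. -/
def axT : Set (Formula n Φ V) :=
  {χ | ∃ (i : Fin n) (φ : Formula n Φ V), χ = imp (K i φ) φ}

/-- 4: `K_i φ ⇒ K_i K_i φ`. -/
def ax4 : Set (Formula n Φ V) :=
  {χ | ∃ (i : Fin n) (φ : Formula n Φ V), χ = imp (K i φ) (K i (K i φ))}

/-- 5^*: `(¬K_i φ ∧ A_i^* φ) ⇒ K_i ¬K_i φ`. -/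
def ax5Star : Set (Formula n Φ V) :=
  {χ | ∃ (i : Fin n) (φ : Formula n Φ V),
    χ = imp (and (neg (K i φ)) (Astar i φ)) (K i (neg (K i φ)))}

/-- AGPP^*: `A_i^* φ ⇔ ⋀_{p ∈ Φ(φ)} A_i^* p`, for every enumeration of `Φ(φ)`. -/
def axAGPPStar : Set (Formula n Φ V) :=
  {χ | ∃ (i : Fin n) (φ : Formula n Φ V) (l : List Φ) (x : V),
    l.Nodup ∧ (∀ p, p ∈ l ↔ p ∈ φ.prims) ∧
      χ = iff (Astar i φ) (conj x (l.map fun p => Astar i (prim p)))}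

/-- A0^*: `K_i φ ⇒ A_i^* φ`. -/
def axA0Star : Set (Formula n Φ V) :=
  {χ | ∃ (i : Fin n) (φ : Formula n Φ V), χ = imp (K i φ) (Astar i φ)}

/-- 1_∀: `∀x φ ⇒ φ[x/ψ]` for a quantifier-free sentence `ψ`. -/
def ax1All : Set (Formula n Φ V) :=
  {χ | ∃ (x : V) (φ ψ : Formula n Φ V), ψ.QuantFree ∧ χ = imp (all x φ) (φ.substVar x ψ)}

/-- K_∀: `∀x (φ ⇒ ψ) ⇒ (∀x φ ⇒ ∀x ψ)`. -/
def axKAll : Set (Formula n Φ V) :=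
  {χ | ∃ (x : V) (φ ψ : Formula n Φ V),
    χ = imp (all x (imp φ ψ)) (imp (all x φ) (all x ψ))}

/-- N_∀: `φ ⇒ ∀x φ` if `x` is not free in `φ`. -/
def axNAll : Set (Formula n Φ V) :=
  {χ | ∃ (x : V) (φ : Formula n Φ V), x ∉ φ.free ∧ χ = imp φ (all x φ)}

/-- Barcan^*: `(A_i^* (∀x φ) ∧ ∀x (A_i^* x ⇒ K_i φ)) ⇒ K_i (∀x A_i^* x ⇒ ∀x φ)`. -/
def axBarcanStar : Set (Formula n Φ V) :=
  {χ | ∃ (i : Fin n) (x : V) (φ : Formula n Φ V),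
    χ = imp (and (Astar i (all x φ)) (all x (imp (Astar i (var x)) (K i φ))))
      (K i (imp (all x (Astar i (var x))) (all x φ)))}

/-- FA^*: `∀x ¬A_i^* x ⇒ K_i ∀x ¬A_i^* x`. -/
def axFAStar : Set (Formula n Φ V) :=
  {χ | ∃ (i : Fin n) (x : V),
    χ = imp (all x (neg (Astar i (var x)))) (K i (all x (neg (Astar i (var x)))))}

end Axioms

/-! ### Axiom systems -/

open Formula in
/-- Provability from the axioms in `Ax` by MP and Gen^* and, in a system with quantification
(`quant`), Gen_∀. -/
inductive Provable {n : ℕ} {Φ V : Type u} (Ax : Set (Formula n Φ V)) (quant : Prop) :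
    Formula n Φ V → Prop
  /-- An axiom is provable. -/
  | ax {φ : Formula n Φ V} : φ ∈ Ax → Provable Ax quant φ
  /-- MP: from `φ` and `φ ⇒ ψ` infer `ψ`. -/
  | mp {φ ψ : Formula n Φ V} :
      Provable Ax quant φ → Provable Ax quant (imp φ ψ) → Provable Ax quant ψ
  /-- Gen^*: from `φ` infer `A_i^* φ ⇒ K_i φ`. -/
  | genStar (i : Fin n) {φ : Formula n Φ V} :
      Provable Ax quant φ → Provable Ax quant (imp (Astar i φ) (K i φ))
  /-- Gen_∀: from `φ` infer `∀x φ[q/x]`. -/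
  | genAll (hquant : quant) (x : V) (q : Φ) {φ : Formula n Φ V} (hx : φ.Substitutable x q) :
      Provable Ax quant φ → Provable Ax quant (all x (φ.substPrim q (var x)))

section Systems

variable (n : ℕ) (Φ V : Type u)

/-- The axiom schemes of `AX^{K,A^*}_e ∪ {T, 4, 5^*}`. -/
def schemesK : Set (Formula n Φ V) :=
  axProp n Φ V ∪ axAGPPStar n Φ V ∪ axK n Φ V ∪ axA0Star n Φ V ∪
    axT n Φ V ∪ ax4 n Φ V ∪ ax5Star n Φ V

/-- The axiom schemes of `AX^{K,A^*,∀}_e ∪ {T, 4, 5^*}`. -/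
def schemesAllK : Set (Formula n Φ V) :=
  schemesK n Φ V ∪ ax1All n Φ V ∪ axKAll n Φ V ∪ axNAll n Φ V ∪
    axBarcanStar n Φ V ∪ axFAStar n Φ V

/-- The axiom schemes of `AX^{K,X,A,A^*,∀}_e ∪ {T, 4, 5^*}`. -/
def schemesAllKXA : Set (Formula n Φ V) :=
  schemesAllK n Φ V ∪ axAGPP n Φ V ∪ axKA n Φ V ∪ axA0 n Φ V

end Systems

variable {n : ℕ} {Φ V : Type u}

/-- Provability in `AX^{K,X,A,A^*,∀}_e ∪ {T, 4, 5^*}`; the axioms are the instances of the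
schemes that are sentences of `L^{∀,K,X,A}_n(Φ,V)`. -/
def ProvableAllKXA (φ : Formula n Φ V) : Prop :=
  Provable (schemesAllKXA n Φ V ∩ LAllKXA n Φ V) True φ

/-- Provability in `AX^{K,A^*,∀}_e ∪ {T, 4, 5^*}`; the axioms are the instances of the
schemes that are sentences of `L^{∀,K}_n(Φ,V)`. -/
def ProvableAllK (φ : Formula n Φ V) : Prop :=
  Provable (schemesAllK n Φ V ∩ LAllK n Φ V) True φ

/-- Provability in `AX^{K,A^*}_e ∪ {T, 4, 5^*}`; the axioms are the instances of the
schemes that belong to `L^K_n(Φ)`. -/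
def ProvableK (φ : Formula n Φ V) : Prop :=
  Provable (schemesK n Φ V ∩ LK n Φ V) False φ

end Awareness

/-!
Completeness is proved through a canonical structure. Its worlds are the maximal consistent sets
of sentences over a sublanguage `L ⊆ Φ` with infinite complement that contain a quantifier-free
counterexample to every universal sentence that they refute; `K_i` relates the worlds at which `i`
knows the same.

If `K_i φ` fails at a world, the accessible world at which `φ` fails or is undefined has the
language `P ∪ Q`, where `P` consists of the primitive propositions that `i` is aware of and `Q` of
fresh ones, of which `i` is unaware. For the languages with quantifiers, `Q` is empty if
`∀x A_i^* x` is consistent with the requirements on the new world, and infinite otherwise. By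
Barcan^* and 5^*, if `φ[x/θ]` follows from these requirements for all `θ` over `P`, then so does
`A_i^* p ⇒ φ[x/p]` for every new `p`; hence a refuted universal sentence has a counterexample over
`P`, or one given by an element of `Q`. By FA^*, `P` is nonempty in the first case.

For soundness, MP is the delicate rule: truth at `s` presupposes `Φ(φ) ⊆ L(s)`, and the premises
may mention primitive propositions that the conclusion does not. Pulling back a structure along a
substitution of quantifier-free sentences for primitive propositions defines the missing ones.
-/

namespace Awareness

variable {n : ℕ} {Φ V : Type u}

namespace Formula

/-! ### Substitution -/

/-- Induction on formulas in which the induction hypothesis of a quantified formula concerns its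
instances by quantifier-free sentences. -/
theorem instanceInduction {motive : Formula n Φ V → Prop}
    (prim : ∀ p, motive (.prim p)) (var : ∀ x, motive (.var x))
    (neg : ∀ φ, motive φ → motive (.neg φ))
    (and : ∀ φ ψ, motive φ → motive ψ → motive (.and φ ψ))
    (K : ∀ i φ, motive φ → motive (.K i φ)) (A : ∀ i φ, motive φ → motive (.A i φ))
    (X : ∀ i φ, motive φ → motive (.X i φ))
    (all : ∀ x φ, (∀ ψ, ψ.QuantFree → motive (φ.substVar x ψ)) → motive (.all x φ))
    (φ : Formula n Φ V) : motive φ := by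
  induction hm : φ.numAll using Nat.strong_induction_on generalizing φ with
  | _ m IH =>
    replace hm := hm.le
    induction φ with
    | prim p => exact prim p
    | var x => exact var x
    | neg φ ih => exact neg φ (ih hm)
    | and φ ψ ih₁ ih₂ =>
      exact and φ ψ (ih₁ ((Nat.le_add_right _ _).trans hm)) (ih₂ ((Nat.le_add_left _ _).trans hm))
    | K i φ ih => exact K i φ (ih hm)
    | A i φ ih => exact A i φ (ih hm)
    | X i φ ih => exact X i φ (ih hm)
    | all x φ _ => exact all x φ fun ψ hψ => IH φ.numAll hm _ (numAll_substVar x hψ φ)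

@[simp] theorem prims_or (φ ψ : Formula n Φ V) : (or φ ψ).prims = φ.prims ∪ ψ.prims := rfl

@[simp] theorem prims_imp (φ ψ : Formula n Φ V) : (imp φ ψ).prims = φ.prims ∪ ψ.prims := rfl

@[simp] theorem prims_iff (φ ψ : Formula n Φ V) : (iff φ ψ).prims = φ.prims ∪ ψ.prims := by
  simp only [iff, prims, prims_imp]
  rw [Set.union_comm ψ.prims, Set.union_self]

@[simp] theorem prims_Astar (i : Fin n) (φ : Formula n Φ V) : (Astar i φ).prims = φ.prims := by
  simp [Astar, prims]

theorem finite_prims (φ : Formula n Φ V) : φ.prims.Finite := by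
  induction φ <;> simp_all [prims]

theorem QuantFree.free_eq_empty {φ : Formula n Φ V} (h : φ.QuantFree) : φ.free = ∅ := by
  induction φ <;> simp_all [QuantFree, free]

theorem QuantFree.prims_nonempty {φ : Formula n Φ V} (h : φ.QuantFree) : φ.prims.Nonempty := by
  induction φ <;> simp_all [QuantFree, prims]

@[simp] theorem substVar_var_self (x : V) (θ : Formula n Φ V) : (var x).substVar x θ = θ := by
  simp [substVar]

@[simp] theorem substVar_imp (x : V) (φ ψ θ : Formula n Φ V) :
    (imp φ ψ).substVar x θ = imp (φ.substVar x θ) (ψ.substVar x θ) := rfl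

@[simp] theorem substVar_neg (x : V) (φ θ : Formula n Φ V) :
    (neg φ).substVar x θ = neg (φ.substVar x θ) := rfl

@[simp] theorem substVar_K (i : Fin n) (x : V) (φ θ : Formula n Φ V) :
    (K i φ).substVar x θ = K i (φ.substVar x θ) := rfl

@[simp] theorem substVar_Astar (i : Fin n) (x : V) (φ θ : Formula n Φ V) :
    (Astar i φ).substVar x θ = Astar i (φ.substVar x θ) := rfl

theorem substVar_of_notMem_free {x : V} {φ : Formula n Φ V} (ψ : Formula n Φ V)
    (h : x ∉ φ.free) : φ.substVar x ψ = φ := by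
  induction φ with
  | var y => simp [substVar, show y ≠ x from fun hy => h hy.symm]
  | all y φ ih =>
    by_cases hy : y = x
    · simp [substVar, hy]
    · simp [substVar, hy, ih fun hx => h ⟨hx, fun hxy => hy hxy.symm⟩]
  | _ => simp_all [free, substVar]

theorem free_substVar {ψ : Formula n Φ V} (hψ : ψ.free = ∅) (x : V) (φ : Formula n Φ V) :
    (φ.substVar x ψ).free = φ.free \ {x} := by
  induction φ with
  | var y => by_cases hy : y = x <;> simp_all [substVar, free, eq_comm]
  | all y φ ih => by_cases hy : y = x <;> simp_all [substVar, free, Set.sdiff_sdiff_comm]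
  | and φ χ ih₁ ih₂ => simp [substVar, free, ih₁, ih₂, Set.union_sdiff_distrib]
  | _ => simp_all [free, substVar]

theorem prims_substVar_subset (x : V) (φ ψ : Formula n Φ V) :
    (φ.substVar x ψ).prims ⊆ φ.prims ∪ ψ.prims := by
  induction φ with
  | var y => by_cases hy : y = x <;> simp [substVar, hy, prims]
  | all y φ ih => by_cases hy : y = x <;> simp_all [substVar, prims]
  | and φ χ ih₁ ih₂ =>
    rw [substVar, prims, prims, Set.union_union_distrib_right]
    exact Set.union_subset_union ih₁ ih₂
  | _ => simp_all [substVar, prims]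

theorem prims_subset_prims_substVar {x : V} {φ : Formula n Φ V} (ψ : Formula n Φ V)
    (h : x ∈ φ.free) : ψ.prims ⊆ (φ.substVar x ψ).prims := by
  induction φ with
  | all y φ ih => by_cases hy : y = x <;> simp_all [free, substVar, prims]
  | and φ χ ih₁ ih₂ =>
    rcases h with h | h
    · exact Set.subset_union_of_subset_left (ih₁ h) _
    · exact Set.subset_union_of_subset_right (ih₂ h) _
  | _ => simp_all [free, substVar, prims]

theorem KOnly.substVar {φ ψ : Formula n Φ V} (hφ : φ.KOnly) (hψ : ψ.KOnly) (x : V) :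
    (φ.substVar x ψ).KOnly := by
  induction φ with
  | var y | all y _ _ => by_cases hy : y = x <;> simp_all [Formula.substVar, KOnly]
  | _ => simp_all [Formula.substVar, KOnly]

theorem KOnly.of_substVar {x : V} {φ ψ : Formula n Φ V} (h : x ∈ φ.free)
    (hφ : (φ.substVar x ψ).KOnly) : ψ.KOnly := by
  induction φ with
  | all y φ ih => by_cases hy : y = x <;> simp_all [free, Formula.substVar, KOnly]
  | and φ χ ih₁ ih₂ => exact h.elim (ih₁ · hφ.1) (ih₂ · hφ.2)
  | _ => simp_all [free, Formula.substVar, KOnly]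

theorem prims_substPrim_var (q : Φ) (x : V) (φ : Formula n Φ V) :
    (φ.substPrim q (var x)).prims = φ.prims \ {q} := by
  induction φ with
  | prim p => by_cases hp : p = q <;> simp_all [substPrim, prims, eq_comm]
  | and φ χ ih₁ ih₂ => simp [substPrim, prims, ih₁, ih₂, Set.union_sdiff_distrib]
  | _ => simp_all [substPrim, prims]

theorem free_substPrim_var_subset (q : Φ) (x : V) (φ : Formula n Φ V) :
    (φ.substPrim q (var x)).free ⊆ insert x φ.free := by
  induction φ with
  | prim p => by_cases hp : p = q <;> simp [substPrim, hp, free]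
  | and φ χ ih₁ ih₂ =>
    simp only [substPrim, free, Set.insert_union_distrib]
    exact Set.union_subset_union ih₁ ih₂
  | all y φ ih =>
    rintro z ⟨hz, hzy⟩
    exact (ih hz).imp_right fun h => ⟨h, hzy⟩
  | _ => simp_all [substPrim, free]

theorem KOnly.substPrim_var {φ : Formula n Φ V} (h : φ.KOnly) (q : Φ) (x : V) :
    (φ.substPrim q (.var x)).KOnly := by
  induction φ with
  | prim p => by_cases hp : p = q <;> simp [substPrim, hp, KOnly]
  | _ => simp_all [substPrim, KOnly]

theorem substPrim_of_notMem_prims {q : Φ} {φ : Formula n Φ V} (ψ : Formula n Φ V)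
    (h : q ∉ φ.prims) : φ.substPrim q ψ = φ := by
  induction φ with
  | prim p => simp [substPrim, show p ≠ q from fun hp => h hp.symm]
  | _ => simp_all [substPrim, prims]

theorem substitutable_of_notMem_prims (x : V) {q : Φ} {φ : Formula n Φ V} (h : q ∉ φ.prims) :
    φ.Substitutable x q := by
  induction φ <;> simp_all [Substitutable, prims]

theorem substitutable_substVar_prim (x : V) {q : Φ} {φ : Formula n Φ V} (h : q ∉ φ.prims) :
    (φ.substVar x (prim q)).Substitutable x q := by
  induction φ with
  | var y => by_cases hy : y = x <;> simp [substVar, hy, Substitutable]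
  | all y φ ih =>
    by_cases hy : y = x
    · simpa [substVar, hy] using substitutable_of_notMem_prims (φ := all x φ) x h
    · simpa [substVar, hy, Substitutable] using ih h
  | _ => simp_all [substVar, Substitutable, prims]

theorem substPrim_substVar_prim (x : V) {q : Φ} {φ : Formula n Φ V} (h : q ∉ φ.prims) :
    (φ.substVar x (prim q)).substPrim q (var x) = φ := by
  induction φ with
  | prim p => simp_all [substVar, substPrim, prims, eq_comm]
  | var y => by_cases hy : y = x <;> simp [substVar, hy, substPrim]
  | all y φ ih =>
    by_cases hy : y = x
    · simpa [substVar, hy] using substPrim_of_notMem_prims (φ := all x φ) _ h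
    · simpa [substVar, hy, substPrim] using ih h
  | _ => simp_all [substVar, substPrim, prims]

/-- All variables that occur in a formula, free or bound; used to choose fresh variables. -/
def vars : Formula n Φ V → Set V
  | prim _ => ∅
  | var x => {x}
  | neg φ => vars φ
  | and φ ψ => vars φ ∪ vars ψ
  | K _ φ => vars φ
  | A _ φ => vars φ
  | X _ φ => vars φ
  | all x φ => insert x (vars φ)

theorem finite_vars (φ : Formula n Φ V) : φ.vars.Finite := by
  induction φ <;> simp_all [vars]

theorem QuantFree.vars_eq_empty {φ : Formula n Φ V} (h : φ.QuantFree) : φ.vars = ∅ := by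
  induction φ <;> simp_all [QuantFree, vars]

theorem vars_substVar_subset {θ : Formula n Φ V} (hθ : θ.QuantFree) (y : V)
    (φ : Formula n Φ V) : (φ.substVar y θ).vars ⊆ φ.vars := by
  induction φ with
  | var x => by_cases hx : x = y <;> simp [substVar, hx, hθ.vars_eq_empty]
  | all x φ ih =>
    by_cases hx : x = y
    · simp [substVar, hx]
    · simpa [substVar, hx, vars] using Set.insert_subset_insert ih
  | and φ ψ ih₁ ih₂ => exact Set.union_subset_union ih₁ ih₂
  | _ => simp_all [substVar, vars]

theorem substitutable_of_notMem_vars {x : V} (q : Φ) {φ : Formula n Φ V} (h : x ∉ φ.vars) :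
    φ.Substitutable x q := by
  induction φ <;> simp_all [Substitutable, vars, eq_comm]

theorem substVar_substPrim_var {z : V} (q : Φ) {φ : Formula n Φ V} (h : z ∉ φ.vars) :
    (φ.substPrim q (var z)).substVar z (prim q) = φ := by
  induction φ with
  | prim p => by_cases hp : p = q <;> simp [substVar, hp, substPrim]
  | var x => simp [substVar, substPrim, show x ≠ z from fun hx => h hx.symm]
  | all x φ ih =>
    obtain ⟨hx, hφ⟩ := not_or.1 h
    simp [substVar, substPrim, Ne.symm hx, ih hφ]
  | _ => simp_all [substVar, substPrim, vars]

theorem substVar_substPrim_comm {y z : V} {q : Φ} {θ : Formula n Φ V} (hyz : y ≠ z)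
    (hq : q ∉ θ.prims) (φ : Formula n Φ V) :
    (φ.substPrim q (var z)).substVar y θ = (φ.substVar y θ).substPrim q (var z) := by
  induction φ with
  | prim p => by_cases hp : p = q <;> simp [substVar, hp, substPrim, hyz.symm]
  | var x => by_cases hx : x = y <;> simp [substVar, hx, substPrim, substPrim_of_notMem_prims _ hq]
  | all x φ ih => by_cases hx : x = y <;> simp [substVar, hx, substPrim, ih]
  | _ => simp_all [substVar, substPrim]

theorem substVar_all_substPrim {y z : V} {q : Φ} {θ : Formula n Φ V} (hzy : z ≠ y)
    (hq : q ∉ θ.prims) (φ : Formula n Φ V) :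
    (all z (φ.substPrim q (var z))).substVar y θ =
      all z ((φ.substVar y θ).substPrim q (var z)) := by
  rw [← substVar_substPrim_comm hzy.symm hq]
  simp [substVar, hzy]

/-- Simultaneous substitution for the primitive propositions. Nothing is renamed, so it is only
used where every `σ p` is quantifier-free, and so contains no variable that could be captured. -/
def bind (σ : Φ → Formula n Φ V) : Formula n Φ V → Formula n Φ V
  | prim p => σ p
  | var x => var x
  | neg φ => neg (bind σ φ)
  | and φ ψ => and (bind σ φ) (bind σ ψ)
  | K i φ => K i (bind σ φ)
  | A i φ => A i (bind σ φ)
  | X i φ => X i (bind σ φ)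
  | all x φ => all x (bind σ φ)

theorem mem_prims_bind {σ : Φ → Formula n Φ V} {φ : Formula n Φ V} {r : Φ} :
    r ∈ (φ.bind σ).prims ↔ ∃ p ∈ φ.prims, r ∈ (σ p).prims := by
  induction φ with
  | and φ χ ih₁ ih₂ => simp only [bind, prims, Set.mem_union, ih₁, ih₂, or_and_right, exists_or]
  | _ => simp_all [bind, prims]

theorem prims_bind_subset {σ : Φ → Formula n Φ V} {φ : Formula n Φ V} {L : Set Φ} :
    (φ.bind σ).prims ⊆ L ↔ ∀ p ∈ φ.prims, (σ p).prims ⊆ L := by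
  simp only [Set.subset_def, mem_prims_bind]
  exact ⟨fun h p hp r hr => h r ⟨p, hp, hr⟩, fun h r ⟨p, hp, hr⟩ => h p hp r hr⟩

theorem free_bind {σ : Φ → Formula n Φ V} (hσ : ∀ p, (σ p).QuantFree) (φ : Formula n Φ V) :
    (φ.bind σ).free = φ.free := by
  induction φ with
  | prim p => simp [bind, free, (hσ p).free_eq_empty]
  | _ => simp_all [bind, free]

theorem QuantFree.bind {σ : Φ → Formula n Φ V} (hσ : ∀ p, (σ p).QuantFree) {φ : Formula n Φ V}
    (h : φ.QuantFree) : (φ.bind σ).QuantFree := by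
  induction φ <;> simp_all [Formula.bind, QuantFree]

theorem KOnly.bind {σ : Φ → Formula n Φ V} (hσ : ∀ p, (σ p).KOnly) {φ : Formula n Φ V}
    (h : φ.KOnly) : (φ.bind σ).KOnly := by
  induction φ <;> simp_all [Formula.bind, KOnly]

theorem bind_congr {σ ρ : Φ → Formula n Φ V} {φ : Formula n Φ V}
    (h : ∀ p ∈ φ.prims, σ p = ρ p) : φ.bind σ = φ.bind ρ := by
  induction φ <;> simp_all [bind, prims]

theorem bind_eq_self {σ : Φ → Formula n Φ V} {φ : Formula n Φ V}
    (h : ∀ p ∈ φ.prims, σ p = prim p) : φ.bind σ = φ := by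
  induction φ <;> simp_all [bind, prims]

theorem bind_bind (σ ρ : Φ → Formula n Φ V) (φ : Formula n Φ V) :
    (φ.bind ρ).bind σ = φ.bind fun p => (ρ p).bind σ := by
  induction φ <;> simp_all [bind]

theorem bind_substVar {σ : Φ → Formula n Φ V} (hσ : ∀ p, (σ p).QuantFree) (x : V)
    (φ ψ : Formula n Φ V) : (φ.substVar x ψ).bind σ = (φ.bind σ).substVar x (ψ.bind σ) := by
  induction φ with
  | prim p =>
    exact (substVar_of_notMem_free (φ := σ p) _ (by simp [(hσ p).free_eq_empty])).symm
  | var y | all y _ _ => by_cases hy : y = x <;> simp_all [substVar, bind]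
  | _ => simp_all [bind, substVar]

theorem substVar_substPrim_eq_bind {σ : Φ → Formula n Φ V} {x : V} {q : Φ} {φ : Formula n Φ V}
    (hσ : ∀ p ∈ φ.prims, p ≠ q → σ p = prim p) (hx : φ.Substitutable x q) (hf : x ∉ φ.free) :
    (φ.substPrim q (var x)).substVar x (σ q) = φ.bind σ := by
  induction φ with
  | prim p => by_cases hp : p = q <;> simp_all [substVar, substPrim, bind, prims]
  | var y => simp_all [substVar, substPrim, bind, free, eq_comm]
  | all y φ ih =>
    by_cases hy : y = x
    · have hq : q ∉ φ.prims := hx.1 hy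
      rw [substPrim_of_notMem_prims (φ := all y φ) _ hq,
        bind_eq_self fun p hp => hσ p hp (ne_of_mem_of_not_mem hp hq)]
      simp [substVar, hy]
    · have hf' : x ∉ φ.free := fun h => hf ⟨h, fun h => hy h.symm⟩
      simp only [substPrim, substVar, hy, if_false, bind]
      rw [ih hσ hx.2 hf']
  | and φ χ ih₁ ih₂ =>
    simp only [free, Set.mem_union, not_or] at hf
    simp only [substPrim, substVar, bind]
    rw [ih₁ (fun p hp => hσ p (.inl hp)) hx.1 hf.1, ih₂ (fun p hp => hσ p (.inr hp)) hx.2 hf.2]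
  | _ => simp_all [substVar, substPrim, bind, prims, free, Substitutable]

/-- A numbering of the formulas, given numberings of the primitive propositions and of the
variables. -/
def code (e : Φ → ℕ) (f : V → ℕ) : Formula n Φ V → ℕ
  | prim p => Nat.pair 0 (e p)
  | var x => Nat.pair 1 (f x)
  | neg φ => Nat.pair 2 (code e f φ)
  | and φ ψ => Nat.pair 3 (Nat.pair (code e f φ) (code e f ψ))
  | K i φ => Nat.pair 4 (Nat.pair i (code e f φ))
  | A i φ => Nat.pair 5 (Nat.pair i (code e f φ))
  | X i φ => Nat.pair 6 (Nat.pair i (code e f φ))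
  | all x φ => Nat.pair 7 (Nat.pair (f x) (code e f φ))

theorem code_injective {e : Φ → ℕ} {f : V → ℕ} (he : e.Injective) (hf : f.Injective) :
    (code e f : Formula n Φ V → ℕ).Injective := by
  intro φ
  induction φ with
  | prim | var => rintro (_ | _) h <;> simp_all [code, Nat.pair_eq_pair, he.eq_iff, hf.eq_iff]
  | neg φ ih => rintro (_ | _) h <;> grind [code, Nat.pair_eq_pair]
  | and φ χ ih₁ ih₂ => rintro (_ | _) h <;> grind [code, Nat.pair_eq_pair]
  | K i φ ih | A i φ ih | X i φ ih => rintro (_ | _) h <;> grind [code, Nat.pair_eq_pair, Fin.ext]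
  | all x φ ih => rintro (_ | _) h <;> grind [code, Nat.pair_eq_pair, Function.Injective]

instance [Countable Φ] [Countable V] : Countable (Formula n Φ V) := by
  obtain ⟨e, he⟩ := exists_injective_nat Φ
  obtain ⟨f, hf⟩ := exists_injective_nat V
  exact (code_injective he hf).countable

end Formula

open Formula

/-! ### Languages -/

/-- The operators available in a language; one development serves the three languages of the
theorem. -/
structure Fragment where
  /-- The operators `A i` and `X i` are missing. -/
  kOnly : Prop
  /-- Quantifiers are available. -/
  quant : Prop

namespace Fragment

/-- `φ` is a sentence of the language `ℒ`. -/
def Sentence (ℒ : Fragment) (φ : Formula n Φ V) : Prop :=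
  φ.IsSentence ∧ (ℒ.kOnly → φ.KOnly) ∧ (¬ ℒ.quant → φ.QuantFree)

/-- The quantifier-free sentences of the language `ℒ`, over which its quantifiers range. -/
def range (ℒ : Fragment) : Set (Formula n Φ V) :=
  {φ | φ.QuantFree ∧ (ℒ.kOnly → φ.KOnly)}

variable {ℒ : Fragment}

@[simp] theorem sentence_prim (p : Φ) : ℒ.Sentence (prim p : Formula n Φ V) := by
  simp [Sentence, IsSentence, free, KOnly, QuantFree]

theorem not_sentence_var {x : V} : ¬ ℒ.Sentence (var x : Formula n Φ V) := by
  simp [Sentence, IsSentence, free]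

@[simp] theorem sentence_neg {φ : Formula n Φ V} : ℒ.Sentence (neg φ) ↔ ℒ.Sentence φ := Iff.rfl

@[simp] theorem sentence_K {i : Fin n} {φ : Formula n Φ V} :
    ℒ.Sentence (K i φ) ↔ ℒ.Sentence φ := Iff.rfl

@[simp] theorem sentence_and {φ ψ : Formula n Φ V} :
    ℒ.Sentence (and φ ψ) ↔ ℒ.Sentence φ ∧ ℒ.Sentence ψ := by
  simp only [Sentence, IsSentence, free, KOnly, QuantFree, Set.union_empty_iff]
  tauto

@[simp] theorem sentence_or {φ ψ : Formula n Φ V} :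
    ℒ.Sentence (or φ ψ) ↔ ℒ.Sentence φ ∧ ℒ.Sentence ψ := by
  simp [Formula.or]

@[simp] theorem sentence_imp {φ ψ : Formula n Φ V} :
    ℒ.Sentence (imp φ ψ) ↔ ℒ.Sentence φ ∧ ℒ.Sentence ψ := by
  simp [imp]

@[simp] theorem sentence_iff {φ ψ : Formula n Φ V} :
    ℒ.Sentence (iff φ ψ) ↔ ℒ.Sentence φ ∧ ℒ.Sentence ψ := by
  simp only [iff, sentence_and, sentence_imp]
  tauto

@[simp] theorem sentence_Astar {i : Fin n} {φ : Formula n Φ V} :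
    ℒ.Sentence (Astar i φ) ↔ ℒ.Sentence φ := by
  simp [Astar]

theorem sentence_A {i : Fin n} {φ : Formula n Φ V} :
    ℒ.Sentence (A i φ) ↔ ¬ ℒ.kOnly ∧ ℒ.Sentence φ := by
  simp only [Sentence, IsSentence, free, KOnly, QuantFree]
  tauto

theorem sentence_X {i : Fin n} {φ : Formula n Φ V} :
    ℒ.Sentence (X i φ) ↔ ¬ ℒ.kOnly ∧ ℒ.Sentence φ := by
  simp only [Sentence, IsSentence, free, KOnly, QuantFree]
  tauto

theorem sentence_all {x : V} {φ : Formula n Φ V} :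
    ℒ.Sentence (all x φ) ↔ ℒ.quant ∧ φ.free ⊆ {x} ∧ (ℒ.kOnly → φ.KOnly) := by
  simp only [Sentence, IsSentence, free, KOnly, QuantFree, Set.sdiff_eq_empty]
  tauto

theorem sentence_of_mem_range {θ : Formula n Φ V} (h : θ ∈ ℒ.range) : ℒ.Sentence θ :=
  ⟨h.1.free_eq_empty, h.2, fun _ => h.1⟩

@[simp] theorem prim_mem_range (p : Φ) : (prim p : Formula n Φ V) ∈ ℒ.range :=
  ⟨trivial, fun _ => trivial⟩

theorem bind_mem_range {σ : Φ → Formula n Φ V} (hσ : ∀ p, σ p ∈ ℒ.range) {φ : Formula n Φ V}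
    (h : φ ∈ ℒ.range) : φ.bind σ ∈ ℒ.range :=
  ⟨h.1.bind fun p => (hσ p).1, fun hk => (h.2 hk).bind fun p => (hσ p).2 hk⟩

theorem Sentence.substVar {x : V} {φ θ : Formula n Φ V} (h : ℒ.Sentence (all x φ))
    (hθ : θ ∈ ℒ.range) : ℒ.Sentence (φ.substVar x θ) := by
  obtain ⟨hq, hfree, hkOnly⟩ := sentence_all.1 h
  refine ⟨?_, fun hk => (hkOnly hk).substVar (hθ.2 hk) x, fun hq' => (hq' hq).elim⟩
  rwa [IsSentence, free_substVar hθ.1.free_eq_empty, Set.sdiff_eq_empty]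

theorem Sentence.all_substPrim {φ : Formula n Φ V} (h : ℒ.Sentence φ) (hq : ℒ.quant) (x : V)
    (p : Φ) : ℒ.Sentence (all x (φ.substPrim p (var x))) := by
  have hfree := free_substPrim_var_subset p x φ
  rw [h.1, LawfulSingleton.insert_empty_eq] at hfree
  exact sentence_all.2 ⟨hq, hfree, fun hk => (h.2.1 hk).substPrim_var p x⟩

theorem Sentence.all_all_substPrim {x : V} {φ : Formula n Φ V} (h : ℒ.Sentence (all x φ)) (z : V)
    (p : Φ) : ℒ.Sentence (all x (all z (φ.substPrim p (var z)))) := by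
  obtain ⟨hq, hfree, hkOnly⟩ := sentence_all.1 h
  refine sentence_all.2 ⟨hq, ?_, fun hk => (hkOnly hk).substPrim_var p z⟩
  rintro y ⟨hy, hyz⟩
  exact hfree ((free_substPrim_var_subset p z φ hy).resolve_left hyz)

end Fragment

open Fragment

/-! ### Truth -/

namespace ExtStructure

variable {M : ExtStructure n Φ V} {R : Set (Formula n Φ V)} {s t : M.World} {i : Fin n}

theorem Sat.prims_subset {φ : Formula n Φ V} (h : M.Sat R s φ) : φ.prims ⊆ M.lang s := by
  induction φ <;> rw [Sat] at h <;> simp_all [prims]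

theorem sat_neg {φ : Formula n Φ V} (h : φ.prims ⊆ M.lang s) :
    M.Sat R s (neg φ) ↔ ¬ M.Sat R s φ := by
  rw [Sat]
  exact and_iff_right h

theorem sat_and {φ ψ : Formula n Φ V} :
    M.Sat R s (and φ ψ) ↔ M.Sat R s φ ∧ M.Sat R s ψ := by
  rw [Sat]

theorem sat_or {φ ψ : Formula n Φ V} (h : (or φ ψ).prims ⊆ M.lang s) :
    M.Sat R s (or φ ψ) ↔ M.Sat R s φ ∨ M.Sat R s ψ := by
  obtain ⟨hφ, hψ⟩ : φ.prims ⊆ M.lang s ∧ ψ.prims ⊆ M.lang s := Set.union_subset_iff.1 h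
  rw [Formula.or, sat_neg (by exact h), sat_and, sat_neg hφ, sat_neg hψ]
  tauto

theorem sat_imp {φ ψ : Formula n Φ V} (h : (imp φ ψ).prims ⊆ M.lang s) :
    M.Sat R s (imp φ ψ) ↔ (M.Sat R s φ → M.Sat R s ψ) := by
  rw [imp, sat_or (by exact h), sat_neg (by exact (Set.union_subset_iff.1 h).1)]
  tauto

theorem Sat.mp {φ ψ : Formula n Φ V} (h : M.Sat R s (imp φ ψ)) (hφ : M.Sat R s φ) :
    M.Sat R s ψ :=
  (sat_imp h.prims_subset).1 h hφ

theorem sat_iff {φ ψ : Formula n Φ V} (h : (iff φ ψ).prims ⊆ M.lang s) :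
    M.Sat R s (iff φ ψ) ↔ (M.Sat R s φ ↔ M.Sat R s ψ) := by
  obtain ⟨h₁, h₂⟩ := Set.union_subset_iff.1 h
  rw [iff, sat_and, sat_imp h₁, sat_imp h₂]
  tauto

theorem sat_K {φ : Formula n Φ V} (h : φ.prims ⊆ M.lang s) :
    M.Sat R s (K i φ) ↔ ∀ t, M.rel i s t → M.Sat R t φ := by
  rw [Sat]
  exact and_iff_right h

theorem sat_A {φ : Formula n Φ V} : M.Sat R s (A i φ) ↔ φ ∈ M.aware i s := by
  rw [Sat]
  exact and_iff_right_of_imp (M.aware_lang _ _ _)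

theorem sat_X {φ : Formula n Φ V} :
    M.Sat R s (X i φ) ↔ M.Sat R s (A i φ) ∧ M.Sat R s (K i φ) := by
  rw [Sat, Sat, Sat]

theorem sat_all {x : V} {φ : Formula n Φ V} (h : φ.prims ⊆ M.lang s) :
    M.Sat R s (all x φ) ↔ ∀ ψ : Formula n Φ V, ψ.QuantFree → ψ ∈ R → ψ.prims ⊆ M.lang s →
        M.Sat R s (φ.substVar x ψ) := by
  rw [Sat]
  exact and_iff_right h

theorem sat_or_neg {φ : Formula n Φ V} : M.Sat R s (or φ (neg φ)) ↔ φ.prims ⊆ M.lang s := by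
  refine ⟨fun h => (Set.union_subset_iff.1 h.prims_subset).1, fun h => ?_⟩
  rw [sat_or (by exact Set.union_subset h h), sat_neg h]
  exact em _

theorem sat_Astar {φ : Formula n Φ V} (h : φ.prims ⊆ M.lang s) :
    M.Sat R s (Astar i φ) ↔ ∀ t, M.rel i s t → φ.prims ⊆ M.lang t := by
  rw [Astar, sat_K (by exact Set.union_subset h h)]
  simp only [sat_or_neg]

theorem sat_verum (x : V) : M.Sat R s (verum x) := by
  rw [verum, sat_all (by simp [prims])]
  intro ψ _ _ hs
  simpa [Formula.or, substVar] using sat_or_neg.2 hs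

theorem sat_conj {x : V} {l : List (Formula n Φ V)} :
    M.Sat R s (conj x l) ↔ ∀ φ ∈ l, M.Sat R s φ := by
  induction l using conj.induct with
  | case1 => simpa [conj] using sat_verum x
  | case2 φ => simp [conj]
  | case3 φ ψ l ih => simp only [conj, sat_and, ih, List.forall_mem_cons]

theorem IsNrte.symm (hM : M.IsNrte) (h : M.rel i s t) : M.rel i t s :=
  hM.eucl i s t s h (hM.refl i s)

theorem IsNrte.sat_Astar_of_rel (hM : M.IsNrte) (hst : M.rel i s t) {φ : Formula n Φ V}
    (h : M.Sat R s (Astar i φ)) : M.Sat R t (Astar i φ) := by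
  have hs : φ.prims ⊆ M.lang s := prims_Astar i φ ▸ h.prims_subset
  have hall := (sat_Astar hs).1 h
  exact (sat_Astar (hall t hst)).2 fun u hu => hall u (hM.trans i s t u hst hu)

end ExtStructure

/-! ### Pulling back a structure along a substitution -/

/-- A substitution of quantifier-free sentences for the primitive propositions, together with a
primitive proposition `lift r` that is mapped to `r`, for every primitive proposition `r`. A
structure can be pulled back along it: by surjectivity the languages of the worlds remain nonempty
and the quantifiers keep their range. -/
structure LiftingSubst (ℒ : Fragment) (n : ℕ) (Φ V : Type u) where
  /-- The formula substituted for a primitive proposition. -/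
  toFun : Φ → Formula n Φ V
  /-- A primitive proposition with a given image. -/
  lift : Φ → Φ
  mem_range : ∀ p, toFun p ∈ ℒ.range
  toFun_lift : ∀ r, toFun (lift r) = prim r

open Classical in
theorem LiftingSubst.exists_eqOn [Infinite Φ] {ℒ : Fragment} {F : Set Φ} (hF : F.Finite)
    {g : Φ → Formula n Φ V} (hg : ∀ p, g p ∈ ℒ.range) :
    ∃ σ : LiftingSubst ℒ n Φ V, ∀ p ∈ F, σ.toFun p = g p := by
  obtain ⟨e⟩ : Nonempty (Φ ≃ ↥Fᶜ) := by
    rw [← Cardinal.eq, Cardinal.mk_compl_of_infinite F (hF.lt_aleph0.trans_le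
      (Cardinal.aleph0_le_mk Φ))]
  refine ⟨⟨fun p => if h : p ∈ F then g p else prim (e.symm ⟨p, h⟩), fun r => e r, fun p => ?_,
    fun r => ?_⟩, fun p hp => by simp [hp]⟩
  · by_cases h : p ∈ F <;> simp [h, hg]
  · have h : (e r : Φ) ∉ F := (e r).2
    simp [h]

theorem LiftingSubst.exists_bind_eq {ℒ : Fragment} (σ : LiftingSubst ℒ n Φ V)
    {ψ : Formula n Φ V} (hψ : ψ ∈ ℒ.range) : ∃ θ ∈ ℒ.range, θ.bind σ.toFun = ψ := by
  refine ⟨ψ.bind fun r => prim (σ.lift r), bind_mem_range (fun _ => prim_mem_range _) hψ, ?_⟩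
  rw [bind_bind]
  exact bind_eq_self fun p _ => σ.toFun_lift p

namespace ExtStructure

variable {M : ExtStructure n Φ V} {ℒ : Fragment} {σ : LiftingSubst ℒ n Φ V} {s : M.World}

open Classical in
/-- The structure in which the primitive proposition `p` has the meaning that its image under `σ`
has in `M`. -/
noncomputable abbrev pullback (M : ExtStructure n Φ V) (σ : LiftingSubst ℒ n Φ V) :
    ExtStructure n Φ V where
  World := M.World
  lang s := {p | (σ.toFun p).prims ⊆ M.lang s}
  lang_nonempty s := by
    obtain ⟨r, hr⟩ := M.lang_nonempty s
    exact ⟨σ.lift r, by simpa [σ.toFun_lift, prims] using hr⟩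
  val s p := decide (M.Sat ℒ.range s (σ.toFun p))
  rel := M.rel
  aware i s := {φ | φ.IsSentence ∧ φ.bind σ.toFun ∈ M.aware i s}
  aware_sentence _ _ _ h := h.1
  aware_lang i s φ h p hp := prims_bind_subset.1 (M.aware_lang _ _ _ h.2) p hp

theorem prims_subset_lang_pullback {φ : Formula n Φ V} :
    φ.prims ⊆ (M.pullback σ).lang s ↔ (φ.bind σ.toFun).prims ⊆ M.lang s :=
  prims_bind_subset.symm

theorem isSentence_bind {φ : Formula n Φ V} : (φ.bind σ.toFun).IsSentence ↔ φ.IsSentence := by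
  rw [IsSentence, IsSentence, free_bind fun p => (σ.mem_range p).1]

theorem mem_aware_pullback {i : Fin n} {φ : Formula n Φ V} :
    φ ∈ (M.pullback σ).aware i s ↔ φ.bind σ.toFun ∈ M.aware i s :=
  and_iff_right_of_imp fun h => isSentence_bind.1 (M.aware_sentence _ _ _ h)

theorem sat_pullback {φ : Formula n Φ V} :
    (M.pullback σ).Sat ℒ.range s φ ↔ M.Sat ℒ.range s (φ.bind σ.toFun) := by
  induction φ using instanceInduction generalizing s with
  | prim p =>
    rw [Formula.bind, Sat.eq_1]
    simp only [Set.mem_ofPred_eq, decide_eq_true_eq]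
    exact and_iff_right_of_imp Sat.prims_subset
  | var x => rw [Formula.bind, Sat, Sat]
  | neg φ ih => rw [Formula.bind, Sat, Sat, prims_subset_lang_pullback, ih]
  | and φ ψ ih₁ ih₂ => rw [Formula.bind, Sat, Sat, ih₁, ih₂]
  | K i φ ih =>
    rw [Formula.bind, Sat, Sat, prims_subset_lang_pullback]
    simp only [ih]
  | A i φ _ => rw [Formula.bind, Sat, Sat, prims_subset_lang_pullback, mem_aware_pullback]
  | X i φ ih =>
    rw [Formula.bind, Sat, Sat, prims_subset_lang_pullback, mem_aware_pullback]
    simp only [ih]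
  | all x φ ih =>
    rw [Formula.bind, Sat, Sat, prims_subset_lang_pullback]
    refine and_congr_right fun _ => ⟨fun h ψ hψ hR hs => ?_, fun h ψ hψ hR hs => ?_⟩
    · obtain ⟨θ, hθ, rfl⟩ := σ.exists_bind_eq hR
      rw [← bind_substVar fun p => (σ.mem_range p).1, ← ih θ hθ.1]
      exact h θ hθ.1 hθ (prims_subset_lang_pullback.2 hs)
    · rw [ih ψ hψ, bind_substVar fun p => (σ.mem_range p).1]
      have hbind := bind_mem_range σ.mem_range hR
      exact h _ hbind.1 hbind (prims_subset_lang_pullback.1 hs)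

theorem IsNrte.pullback (hM : M.IsNrte) (σ : LiftingSubst ℒ n Φ V) : (M.pullback σ).IsNrte where
  agpp i s φ hφ := by
    have hprim : ∀ p, prim p ∈ (M.pullback σ).aware i s ↔
        ∀ r ∈ (σ.toFun p).prims, prim r ∈ M.aware i s := fun p => by
      have hp : (prim p : Formula n Φ V).IsSentence := rfl
      rw [mem_aware_pullback, hM.agpp i s _ (isSentence_bind.2 hp), Formula.bind]
    rw [mem_aware_pullback, hM.agpp i s _ (isSentence_bind.2 hφ)]
    simp only [hprim, mem_prims_bind]
    exact ⟨fun h p hp r hr => h r ⟨p, hp, hr⟩, fun h r ⟨p, hp, hr⟩ => h p hp r hr⟩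
  ka i s t h := by
    ext φ
    rw [mem_aware_pullback, mem_aware_pullback, hM.ka i s t h]
  refl := hM.refl
  trans := hM.trans
  eucl := hM.eucl

end ExtStructure

/-! ### Provability and soundness -/

namespace Fragment

/-- The axioms of the system for the language `ℒ`: the instances of its schemes that are sentences
of `ℒ`. -/
def schemeInstances (ℒ : Fragment) : Set (Formula n Φ V) :=
  {φ | (φ ∈ schemesK n Φ V ∨ (ℒ.quant ∧ φ ∈ schemesAllK n Φ V) ∨
    (¬ ℒ.kOnly ∧ φ ∈ axAGPP n Φ V ∪ axKA n Φ V ∪ axA0 n Φ V)) ∧ ℒ.Sentence φ}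

/-- Provability in the system for the language `ℒ`. -/
def Proves (ℒ : Fragment) (φ : Formula n Φ V) : Prop := Provable ℒ.schemeInstances ℒ.quant φ

theorem Proves.sentence {ℒ : Fragment} {φ : Formula n Φ V} (h : ℒ.Proves φ) : ℒ.Sentence φ := by
  induction h with
  | ax h => exact h.2
  | mp _ _ _ ih => exact (sentence_imp.1 ih).2
  | genStar i _ ih => simpa using ih
  | genAll hq x p _ _ ih => exact ih.all_substPrim hq x p

end Fragment

open ExtStructure

section Soundness

variable {M : ExtStructure n Φ V} {s : M.World} {R : Set (Formula n Φ V)} {ℒ : Fragment}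
  {χ : Formula n Φ V}

open Classical in
theorem sat_inst {σ : ℕ → Formula n Φ V} {θ : PropForm} (h : (θ.inst σ).prims ⊆ M.lang s) :
    M.Sat R s (θ.inst σ) ↔ θ.eval (fun m => decide (M.Sat R s (σ m))) = true := by
  induction θ with
  | atom m => simp [PropForm.inst, PropForm.eval]
  | neg θ ih =>
    rw [PropForm.inst, sat_neg (by exact h), ih h]
    simp [PropForm.eval]
  | and θ η ih₁ ih₂ =>
    obtain ⟨hθ, hη⟩ := Set.union_subset_iff.1 h
    rw [PropForm.inst, sat_and, ih₁ hθ, ih₂ hη]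
    simp [PropForm.eval]

theorem valid_axProp (h : χ ∈ axProp n Φ V) : Valid R χ := by
  obtain ⟨θ, σ, hθ, rfl⟩ := h
  exact fun M _ s hs => (sat_inst hs).2 (hθ _)

theorem valid_axAGPPStar (h : χ ∈ axAGPPStar n Φ V) : Valid R χ := by
  obtain ⟨i, φ, l, x, -, hl, rfl⟩ := h
  intro M _ s hs
  have hφ : φ.prims ⊆ M.lang s := by
    rw [prims_iff, prims_Astar] at hs
    exact (Set.union_subset_iff.1 hs).1
  have hprim : ∀ p ∈ φ.prims, (M.Sat R s (Astar i (prim p)) ↔ ∀ t, M.rel i s t → p ∈ M.lang t) :=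
    fun p hp => (sat_Astar (by simpa [prims] using hφ hp)).trans (by simp [prims])
  rw [sat_iff hs, sat_Astar hφ, sat_conj]
  simp only [List.forall_mem_map, hl]
  rw [forall₂_congr hprim]
  exact ⟨fun h p hp t ht => h t ht hp, fun h t ht p hp => h p hp t ht⟩

theorem valid_axK (h : χ ∈ axK n Φ V) : Valid R χ := by
  obtain ⟨i, φ, ψ, rfl⟩ := h
  intro M _ s hs
  rw [sat_imp hs, sat_and]
  simp only [prims_imp, prims, Set.union_subset_iff] at hs
  rw [sat_K hs.2, sat_K hs.1.1, sat_K (by exact Set.union_subset hs.1.1 hs.2)]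
  exact fun ⟨hφ, himp⟩ t ht => (himp t ht).mp (hφ t ht)

theorem valid_axA0Star (h : χ ∈ axA0Star n Φ V) : Valid R χ := by
  obtain ⟨i, φ, rfl⟩ := h
  intro M _ s hs
  have hφ : φ.prims ⊆ M.lang s := (Set.union_subset_iff.1 hs).1
  rw [sat_imp hs, sat_K hφ, sat_Astar hφ]
  exact fun h t ht => (h t ht).prims_subset

theorem valid_axT (h : χ ∈ axT n Φ V) : Valid R χ := by
  obtain ⟨i, φ, rfl⟩ := h
  intro M hM s hs
  rw [sat_imp hs, sat_K (by exact (Set.union_subset_iff.1 hs).1)]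
  exact fun h => h s (hM.refl i s)

theorem valid_ax4 (h : χ ∈ ax4 n Φ V) : Valid R χ := by
  obtain ⟨i, φ, rfl⟩ := h
  intro M hM s hs
  have hφ : φ.prims ⊆ M.lang s := (Set.union_subset_iff.1 hs).1
  rw [sat_imp hs, sat_K hφ, sat_K (by exact hφ)]
  intro h t ht
  rw [sat_K (h t ht).prims_subset]
  exact fun u hu => h u (hM.trans i s t u ht hu)

theorem valid_ax5Star (h : χ ∈ ax5Star n Φ V) : Valid R χ := by
  obtain ⟨i, φ, rfl⟩ := h
  intro M hM s hs
  have hφ : φ.prims ⊆ M.lang s := (Set.union_subset_iff.1 hs).2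
  rw [sat_imp hs, sat_and, sat_neg (by exact hφ), sat_K hφ, sat_Astar hφ, sat_K (by exact hφ)]
  rintro ⟨hK, haware⟩ t ht
  rw [sat_neg (by exact haware t ht), sat_K (haware t ht)]
  exact fun h => hK fun u hu => h u (hM.eucl i s t u ht hu)

theorem valid_ax1All (h : χ ∈ ax1All n Φ V) (hχ : ℒ.Sentence χ) : Valid ℒ.range χ := by
  obtain ⟨x, φ, ψ, hψ, rfl⟩ := h
  intro M _ s hs
  obtain ⟨hφs, hψs⟩ := Set.union_subset_iff.1 hs
  rw [sat_imp hs, sat_all (by exact hφs)]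
  intro h
  by_cases hx : x ∈ φ.free
  · exact h ψ hψ ⟨hψ, fun hk => ((sentence_imp.1 hχ).2.2.1 hk).of_substVar hx⟩
      ((prims_subset_prims_substVar ψ hx).trans hψs)
  · obtain ⟨p, hp⟩ := M.lang_nonempty s
    have hinst := h (prim p) trivial (prim_mem_range p) (by simpa [prims] using hp)
    rwa [substVar_of_notMem_free _ hx] at hinst ⊢

theorem valid_axKAll (h : χ ∈ axKAll n Φ V) : Valid R χ := by
  obtain ⟨x, φ, ψ, rfl⟩ := h
  intro M _ s hs
  obtain ⟨hall, himp⟩ := Set.union_subset_iff.1 hs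
  obtain ⟨hφ, hψ⟩ := Set.union_subset_iff.1 himp
  rw [sat_imp hs, sat_imp himp, sat_all (by exact hall), sat_all (by exact hφ),
    sat_all (by exact hψ)]
  exact fun h₁ h₂ θ hθ hR hθs => (h₁ θ hθ hR hθs).mp (h₂ θ hθ hR hθs)

theorem valid_axNAll (h : χ ∈ axNAll n Φ V) : Valid R χ := by
  obtain ⟨x, φ, hx, rfl⟩ := h
  intro M _ s hs
  rw [sat_imp hs, sat_all (by exact (Set.union_subset_iff.1 hs).2)]
  intro h θ _ _ _
  rwa [substVar_of_notMem_free _ hx]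

theorem valid_axBarcanStar (h : χ ∈ axBarcanStar n Φ V) : Valid R χ := by
  obtain ⟨i, x, φ, rfl⟩ := h
  intro M hM s hs
  have hφ : φ.prims ⊆ M.lang s := by simpa [prims] using hs
  rw [sat_imp hs, sat_and, sat_Astar (by exact hφ), sat_all (by simpa [prims] using hφ),
    sat_K (by simpa [prims] using hφ)]
  rintro ⟨haware, hall⟩ t ht
  have hφt : φ.prims ⊆ M.lang t := haware t ht
  rw [sat_imp (by simpa [prims] using hφt), sat_all (by simp [prims]), sat_all hφt]
  intro hawareOf θ hθ hR hθt
  have hθA : M.Sat R t (Astar i θ) := by simpa using hawareOf θ hθ hR hθt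
  have hθA' := hM.sat_Astar_of_rel (hM.symm ht) hθA
  have hK : M.Sat R s (K i (φ.substVar x θ)) :=
    (by simpa using hall θ hθ hR (prims_Astar i θ ▸ hθA'.prims_subset) :
      M.Sat R s (imp (Astar i θ) (K i (φ.substVar x θ)))).mp hθA'
  exact (sat_K (by exact hK.prims_subset)).1 hK t ht

theorem valid_axFAStar (h : χ ∈ axFAStar n Φ V) : Valid R χ := by
  obtain ⟨i, x, rfl⟩ := h
  intro M hM s hs
  rw [sat_imp hs, sat_K (by simp [prims]), sat_all (by simp [prims])]
  intro h t ht
  rw [sat_all (by simp [prims])]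
  intro θ hθ hR hθt
  suffices hθA : ¬ M.Sat R t (Astar i θ) by simpa [substVar, sat_neg, hθt] using hθA
  intro hθA
  have hθA' := hM.sat_Astar_of_rel (hM.symm ht) hθA
  have hθs : θ.prims ⊆ M.lang s := prims_Astar i θ ▸ hθA'.prims_subset
  have hneg : M.Sat R s (neg (Astar i θ)) := by simpa using h θ hθ hR hθs
  exact (sat_neg (by exact hneg.prims_subset)).1 hneg hθA'

theorem valid_axAGPP (h : χ ∈ axAGPP n Φ V) (hχ : ℒ.Sentence χ) : Valid R χ := by
  obtain ⟨i, φ, l, x, -, hl, rfl⟩ := h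
  intro M hM s hs
  rw [sat_iff hs, sat_A, sat_conj, hM.agpp i s φ (sentence_A.1 (sentence_iff.1 hχ).1).2.1]
  simp only [List.forall_mem_map, hl, sat_A]

theorem valid_axKA (h : χ ∈ axKA n Φ V) : Valid R χ := by
  obtain ⟨i, φ, rfl⟩ := h
  intro M hM s hs
  rw [sat_imp hs, sat_A, sat_K (by exact (Set.union_subset_iff.1 hs).2)]
  intro h t ht
  rwa [sat_A, ← hM.ka i s t ht]

theorem valid_axA0 (h : χ ∈ axA0 n Φ V) : Valid R χ := by
  obtain ⟨i, φ, rfl⟩ := h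
  intro M _ s hs
  rw [sat_iff hs, sat_X, sat_and, and_comm]

theorem valid_of_mem_schemeInstances (h : χ ∈ ℒ.schemeInstances) : Valid ℒ.range χ := by
  have hK : χ ∈ schemesK n Φ V → Valid ℒ.range χ := by
    rintro ((((((h | h) | h) | h) | h) | h) | h)
    exacts [valid_axProp h, valid_axAGPPStar h, valid_axK h, valid_axA0Star h, valid_axT h,
      valid_ax4 h, valid_ax5Star h]
  obtain ⟨h | ⟨-, h⟩ | ⟨-, h⟩, hχ⟩ := h
  · exact hK h
  · rcases h with ((((h | h) | h) | h) | h) | h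
    exacts [hK h, valid_ax1All h hχ, valid_axKAll h, valid_axNAll h, valid_axBarcanStar h,
      valid_axFAStar h]
  · rcases h with (h | h) | h
    exacts [valid_axAGPP h hχ, valid_axKA h, valid_axA0 h]

/-- A structure in which the instance is considered is pulled back along the substitution. -/
theorem Valid.bind [Infinite Φ] (h : Valid ℒ.range χ) {g : Φ → Formula n Φ V}
    (hg : ∀ p, g p ∈ ℒ.range) : Valid ℒ.range (χ.bind g) := by
  intro M hM s hs
  obtain ⟨σ, hσ⟩ := LiftingSubst.exists_eqOn χ.finite_prims hg
  rw [bind_congr fun p hp => (hσ p hp).symm] at hs ⊢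
  exact sat_pullback.1 (h _ (hM.pullback σ) s (prims_subset_lang_pullback.2 hs))

open Classical in
/-- The premises may mention primitive propositions outside the language of a world; a substitution
replaces these by one that is in it. -/
theorem Valid.mp [Infinite Φ] {φ ψ : Formula n Φ V} (hφ : Valid ℒ.range φ)
    (himp : Valid ℒ.range (imp φ ψ)) : Valid ℒ.range ψ := by
  intro M hM s hs
  obtain ⟨p₀, hp₀⟩ := M.lang_nonempty s
  let g : Φ → Formula n Φ V := fun p => if p ∈ ψ.prims then prim p else prim p₀
  have hg : ∀ p, g p ∈ ℒ.range := fun p => by unfold g; split_ifs <;> exact prim_mem_range _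
  have hlang : ∀ θ : Formula n Φ V, (θ.bind g).prims ⊆ M.lang s := fun θ =>
    prims_bind_subset.2 fun p _ => by
      unfold g
      split_ifs with hp
      exacts [Set.singleton_subset_iff.2 (hs hp), Set.singleton_subset_iff.2 hp₀]
  have hψ : ψ.bind g = ψ := bind_eq_self fun p hp => if_pos hp
  rw [← hψ]
  exact Sat.mp (himp.bind hg M hM s (hlang _)) (hφ.bind hg M hM s (hlang φ))

theorem Valid.genStar {φ : Formula n Φ V} (h : Valid R φ) (i : Fin n) :
    Valid R (imp (Astar i φ) (K i φ)) := by
  intro M hM s hs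
  have hφ : φ.prims ⊆ M.lang s := (Set.union_subset_iff.1 hs).2
  rw [sat_imp hs, sat_Astar hφ, sat_K hφ]
  exact fun haware t ht => h M hM t (haware t ht)

open Classical in
theorem Valid.genAll [Infinite Φ] {φ : Formula n Φ V} (h : Valid ℒ.range φ) {x : V} {q : Φ}
    (hx : φ.Substitutable x q) (hφ : x ∉ φ.free) :
    Valid ℒ.range (all x (φ.substPrim q (var x))) := by
  intro M hM s hs
  rw [sat_all (by exact hs)]
  intro θ _ hR hθs
  have hlang := (prims_substVar_subset x (φ.substPrim q (var x)) θ).trans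
    (Set.union_subset hs hθs)
  let g : Φ → Formula n Φ V := fun p => if p = q then θ else prim p
  have hg : ∀ p, g p ∈ ℒ.range := fun p => by
    unfold g
    split_ifs
    exacts [hR, prim_mem_range p]
  have hbind : (φ.substPrim q (var x)).substVar x θ = φ.bind g := by
    simpa [g] using substVar_substPrim_eq_bind (σ := g) (fun p _ hp => if_neg hp) hx hφ
  rw [hbind] at hlang ⊢
  exact h.bind hg M hM s hlang

theorem Fragment.Proves.valid [Infinite Φ] (h : ℒ.Proves χ) : Valid ℒ.range χ := by
  induction h with
  | ax h => exact valid_of_mem_schemeInstances h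
  | mp _ _ ih₁ ih₂ => exact ih₁.mp ih₂
  | genStar i _ ih => exact ih.genStar i
  | genAll _ x p hx h ih =>
    exact ih.genAll hx (Set.eq_empty_iff_forall_notMem.1 (Proves.sentence h).1 x)

end Soundness

/-! ### Propositional reasoning -/

/-- A truth assignment to all formulas that respects the propositional connectives; formulas of
any other form are treated as atoms. -/
structure IsBoolean (v : Formula n Φ V → Prop) : Prop where
  neg : ∀ φ, v (neg φ) ↔ ¬ v φ
  and : ∀ φ ψ, v (and φ ψ) ↔ v φ ∧ v ψ

namespace IsBoolean

variable {v : Formula n Φ V → Prop}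

theorem or (hv : IsBoolean v) (φ ψ : Formula n Φ V) : v (or φ ψ) ↔ v φ ∨ v ψ := by
  rw [Formula.or, hv.neg, hv.and, hv.neg, hv.neg]
  tauto

theorem imp (hv : IsBoolean v) (φ ψ : Formula n Φ V) : v (imp φ ψ) ↔ (v φ → v ψ) := by
  rw [Formula.imp, hv.or, hv.neg]
  tauto

end IsBoolean

/-- The propositional skeleton of a formula; the maximal subformulas that are neither negations nor
conjunctions become the atoms, numbered by `e`. -/
def skeleton (e : Formula n Φ V → ℕ) : Formula n Φ V → PropForm
  | .neg φ => .neg (skeleton e φ)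
  | .and φ ψ => .and (skeleton e φ) (skeleton e ψ)
  | .prim p => .atom (e (.prim p))
  | .var x => .atom (e (.var x))
  | .K i φ => .atom (e (.K i φ))
  | .A i φ => .atom (e (.A i φ))
  | .X i φ => .atom (e (.X i φ))
  | .all x φ => .atom (e (.all x φ))

theorem exists_finite_inst_skeleton_eq (φ : Formula n Φ V) :
    ∃ S : Set (Formula n Φ V), S.Finite ∧ ∀ (e : Formula n Φ V → ℕ) (σ : ℕ → Formula n Φ V),
      Set.LeftInvOn σ e S → (skeleton e φ).inst σ = φ := by
  induction φ with
  | neg φ ih =>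
    obtain ⟨S, hS, h⟩ := ih
    exact ⟨S, hS, fun e σ hσ => by rw [skeleton, PropForm.inst, h e σ hσ]⟩
  | and φ ψ ih₁ ih₂ =>
    obtain ⟨S, hS, h₁⟩ := ih₁
    obtain ⟨T, hT, h₂⟩ := ih₂
    refine ⟨S ∪ T, hS.union hT, fun e σ hσ => ?_⟩
    rw [skeleton, PropForm.inst, h₁ e σ (hσ.mono Set.subset_union_left),
      h₂ e σ (hσ.mono Set.subset_union_right)]
  | _ => exact ⟨_, Set.finite_singleton _, fun e σ hσ => hσ rfl⟩

/-- The implication of `φ` from the members of a list, in curried form. -/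
def impList (l : List (Formula n Φ V)) (φ : Formula n Φ V) : Formula n Φ V := l.foldr imp φ

theorem prims_impList_subset {l : List (Formula n Φ V)} {φ : Formula n Φ V} {L : Set Φ} :
    (impList l φ).prims ⊆ L ↔ (∀ ψ ∈ l, ψ.prims ⊆ L) ∧ φ.prims ⊆ L := by
  induction l with
  | nil => simp [impList]
  | cons a l ih =>
    simp only [impList, List.foldr_cons, prims_imp, List.forall_mem_cons,
      Set.union_subset_iff] at ih ⊢
    tauto

theorem IsBoolean.impList {v : Formula n Φ V → Prop} (hv : IsBoolean v)
    (l : List (Formula n Φ V)) (φ : Formula n Φ V) :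
    v (impList l φ) ↔ ((∀ ψ ∈ l, v ψ) → v φ) := by
  induction l with
  | nil => simp [Awareness.impList]
  | cons a l ih =>
    simp only [Awareness.impList, List.foldr_cons, hv.imp, List.forall_mem_cons] at ih ⊢
    tauto

theorem substVar_impList {l : List (Formula n Φ V)} (hl : ∀ ψ ∈ l, ψ.IsSentence) (x : V)
    (φ θ : Formula n Φ V) : (impList l φ).substVar x θ = impList l (φ.substVar x θ) := by
  induction l with
  | nil => rfl
  | cons a l ih =>
    rw [List.forall_mem_cons] at hl
    have ha : x ∉ a.free := hl.1 ▸ Set.notMem_empty x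
    simp only [impList, List.foldr_cons, substVar_imp, substVar_of_notMem_free θ ha] at ih ⊢
    rw [ih hl.2]

theorem substPrim_impList {l : List (Formula n Φ V)} {p : Φ} (hl : ∀ ψ ∈ l, p ∉ ψ.prims)
    (φ θ : Formula n Φ V) : (impList l φ).substPrim p θ = impList l (φ.substPrim p θ) := by
  induction l with
  | nil => rfl
  | cons a l ih =>
    rw [List.forall_mem_cons] at hl
    simp only [impList, List.foldr_cons, imp, Formula.or, substPrim,
      substPrim_of_notMem_prims θ hl.1] at ih ⊢
    rw [ih hl.2]

theorem substitutable_impList {l : List (Formula n Φ V)} {x : V} {p : Φ} {φ : Formula n Φ V}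
    (hl : ∀ ψ ∈ l, p ∉ ψ.prims) (hφ : φ.Substitutable x p) :
    (impList l φ).Substitutable x p := by
  induction l with
  | nil => exact hφ
  | cons a l ih =>
    rw [List.forall_mem_cons] at hl
    exact ⟨substitutable_of_notMem_prims x hl.1, ih hl.2⟩

namespace Fragment

variable {ℒ : Fragment} {Γ Δ : Set (Formula n Φ V)} {φ ψ χ : Formula n Φ V}

@[simp] theorem sentence_impList {l : List (Formula n Φ V)} :
    ℒ.Sentence (impList l φ) ↔ (∀ ψ ∈ l, ℒ.Sentence ψ) ∧ ℒ.Sentence φ := by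
  induction l with
  | nil => simp [impList]
  | cons a l ih =>
    simp only [impList, List.foldr_cons, sentence_imp, List.forall_mem_cons] at ih ⊢
    tauto

theorem Sentence.all_impList {l : List (Formula n Φ V)} {x : V} (hl : ∀ ψ ∈ l, ℒ.Sentence ψ)
    (h : ℒ.Sentence (all x φ)) : ℒ.Sentence (all x (impList l φ)) := by
  induction l with
  | nil => exact h
  | cons a l ih =>
    rw [List.forall_mem_cons] at hl
    obtain ⟨hq, hfree, hkOnly⟩ := sentence_all.1 (ih hl.2)
    refine sentence_all.2 ⟨hq, Set.union_subset ?_ hfree, fun hk => ⟨hl.1.2.1 hk, hkOnly hk⟩⟩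
    exact hl.1.1.trans_subset (Set.empty_subset _)

/-- Derivability of a sentence from a set of sentences. -/
def Derives (ℒ : Fragment) (Γ : Set (Formula n Φ V)) (φ : Formula n Φ V) : Prop :=
  ∃ l : List (Formula n Φ V), (∀ ψ ∈ l, ψ ∈ Γ) ∧ ℒ.Proves (impList l φ)

/-- No contradiction is derivable from `Γ`. -/
def Consistent (ℒ : Fragment) (Γ : Set (Formula n Φ V)) : Prop :=
  ∀ φ, ℒ.Derives Γ φ → ¬ ℒ.Derives Γ (neg φ)

theorem Proves.of_schemesK (h : φ ∈ schemesK n Φ V) (hφ : ℒ.Sentence φ) : ℒ.Proves φ :=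
  .ax ⟨.inl h, hφ⟩

theorem Proves.of_schemesAllK (hq : ℒ.quant) (h : φ ∈ schemesAllK n Φ V) (hφ : ℒ.Sentence φ) :
    ℒ.Proves φ :=
  .ax ⟨.inr (.inl ⟨hq, h⟩), hφ⟩

theorem Proves.mp (h₁ : ℒ.Proves (imp φ ψ)) (h₂ : ℒ.Proves φ) : ℒ.Proves ψ :=
  Provable.mp h₂ h₁

theorem Proves.of_tautology (hφ : ℒ.Sentence φ) (h : ∀ v, IsBoolean v → v φ) : ℒ.Proves φ := by
  obtain ⟨S, hS, hinst⟩ := exists_finite_inst_skeleton_eq φ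
  obtain ⟨e, he⟩ := Set.countable_iff_exists_injOn.1 hS.countable
  have : Nonempty (Formula n Φ V) := ⟨φ⟩
  have hprop : φ ∈ axProp n Φ V := by
    refine ⟨skeleton e φ, Function.invFunOn e S, fun b => ?_,
      (hinst e _ he.leftInvOn_invFunOn).symm⟩
    refine h (fun ψ => (skeleton e ψ).eval b = true) ⟨fun ψ => ?_, fun ψ χ => ?_⟩ <;>
      simp [skeleton, PropForm.eval]
  exact .of_schemesK (.inl (.inl (.inl (.inl (.inl (.inl hprop)))))) hφ

theorem Proves.derives (h : ℒ.Proves φ) : ℒ.Derives Γ φ := ⟨[], by simp, h⟩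

theorem Derives.sentence (h : ℒ.Derives Γ φ) : ℒ.Sentence φ := by
  obtain ⟨l, -, h⟩ := h
  exact (sentence_impList.1 h.sentence).2

theorem Derives.mono (h : ℒ.Derives Γ φ) (hΓ : Γ ⊆ Δ) : ℒ.Derives Δ φ := by
  obtain ⟨l, hl, h⟩ := h
  exact ⟨l, fun ψ hψ => hΓ (hl ψ hψ), h⟩

theorem Derives.of_mem (h : φ ∈ Γ) (hφ : ℒ.Sentence φ) : ℒ.Derives Γ φ :=
  ⟨[φ], by simpa using h, .of_tautology (by simp [hφ]) fun v hv => by simp [hv.impList]⟩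

theorem Derives.mp (h₁ : ℒ.Derives Γ (imp φ ψ)) (h₂ : ℒ.Derives Γ φ) : ℒ.Derives Γ ψ := by
  obtain ⟨l₁, hl₁, h₁⟩ := h₁
  obtain ⟨l₂, hl₂, h₂⟩ := h₂
  refine ⟨l₁ ++ l₂, fun χ hχ => (List.mem_append.1 hχ).elim (hl₁ χ) (hl₂ χ), ?_⟩
  have htaut : ℒ.Proves (imp (impList l₁ (imp φ ψ))
      (imp (impList l₂ φ) (impList (l₁ ++ l₂) ψ))) := by
    refine .of_tautology ?_ fun v hv => ?_
    · have hs₁ := sentence_impList.1 h₁.sentence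
      have hs₂ := sentence_impList.1 h₂.sentence
      have hs := sentence_imp.1 hs₁.2
      simp only [sentence_imp, sentence_impList, List.mem_append]
      exact ⟨hs₁.imp_right fun _ => hs, hs₂, fun χ hχ => hχ.elim (hs₁.1 χ) (hs₂.1 χ), hs.2⟩
    · simp only [hv.imp, hv.impList, List.mem_append]
      exact fun h₁ h₂ h => h₁ (fun χ hχ => h χ (.inl hχ)) (h₂ fun χ hχ => h χ (.inr hχ))
  exact (htaut.mp h₁).mp h₂

theorem Derives.of_tautology (h : ℒ.Derives Γ φ) (hψ : ℒ.Sentence ψ)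
    (hv : ∀ v, IsBoolean v → v φ → v ψ) : ℒ.Derives Γ ψ :=
  (Proves.of_tautology (sentence_imp.2 ⟨h.sentence, hψ⟩) fun v h =>
    (h.imp _ _).2 (hv v h)).derives.mp h

theorem Derives.and_left (h : ℒ.Derives Γ (and φ ψ)) : ℒ.Derives Γ φ :=
  h.of_tautology (sentence_and.1 h.sentence).1 fun _ hv h => ((hv.and _ _).1 h).1

theorem Derives.and_right (h : ℒ.Derives Γ (and φ ψ)) : ℒ.Derives Γ ψ :=
  h.of_tautology (sentence_and.1 h.sentence).2 fun _ hv h => ((hv.and _ _).1 h).2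

theorem Derives.and_intro (h₁ : ℒ.Derives Γ φ) (h₂ : ℒ.Derives Γ ψ) : ℒ.Derives Γ (and φ ψ) := by
  refine (h₁.of_tautology (ψ := imp ψ (and φ ψ)) ?_ fun v hv h => ?_).mp h₂
  · simp [h₁.sentence, h₂.sentence]
  · rw [hv.imp, hv.and]
    exact fun h' => ⟨h, h'⟩

theorem Derives.iff_mp (h : ℒ.Derives Γ (iff φ ψ)) (hφ : ℒ.Derives Γ φ) : ℒ.Derives Γ ψ :=
  h.and_left.mp hφ

theorem Derives.iff_mpr (h : ℒ.Derives Γ (iff φ ψ)) (hψ : ℒ.Derives Γ ψ) : ℒ.Derives Γ φ :=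
  h.and_right.mp hψ

theorem Derives.imp_of_right (h : ℒ.Derives Γ ψ) (hφ : ℒ.Sentence φ) : ℒ.Derives Γ (imp φ ψ) :=
  h.of_tautology (sentence_imp.2 ⟨hφ, h.sentence⟩) fun _ hv h => (hv.imp _ _).2 fun _ => h

theorem Derives.imp_of_neg (h : ℒ.Derives Γ (neg φ)) (hψ : ℒ.Sentence ψ) :
    ℒ.Derives Γ (imp φ ψ) :=
  h.of_tautology (sentence_imp.2 ⟨h.sentence, hψ⟩) fun _ hv h =>
    (hv.imp _ _).2 fun h' => ((hv.neg _).1 h h').elim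

theorem Derives.of_neg_neg (h : ℒ.Derives Γ (neg (neg φ))) : ℒ.Derives Γ φ :=
  h.of_tautology h.sentence fun _ hv h => not_not.1 fun h' => (hv.neg _).1 h ((hv.neg _).2 h')

theorem Derives.neg_of_imp (h₁ : ℒ.Derives Γ (imp φ ψ)) (h₂ : ℒ.Derives Γ (imp φ (neg ψ))) :
    ℒ.Derives Γ (neg φ) :=
  (h₁.and_intro h₂).of_tautology (sentence_imp.1 h₁.sentence).1 fun _ hv h => by
    rw [hv.and, hv.imp, hv.imp, hv.neg] at h
    rw [hv.neg]
    tauto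

theorem Derives.of_imp_of_neg_imp (h₁ : ℒ.Derives Γ (imp φ ψ))
    (h₂ : ℒ.Derives Γ (imp (neg φ) ψ)) : ℒ.Derives Γ ψ :=
  (h₁.and_intro h₂).of_tautology (sentence_imp.1 h₁.sentence).2 fun _ hv h => by
    rw [hv.and, hv.imp, hv.imp, hv.neg] at h
    tauto

theorem Derives.deduction (h : ℒ.Derives (insert φ Γ) ψ) (hφ : ℒ.Sentence φ) :
    ℒ.Derives Γ (imp φ ψ) := by
  classical
  obtain ⟨l, hl, h⟩ := h
  have hs := sentence_impList.1 h.sentence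
  refine ⟨l.filter (· ≠ φ), fun χ hχ => ?_, Proves.mp (.of_tautology ?_ fun v hv => ?_) h⟩
  · obtain ⟨hχl, hχφ⟩ := List.mem_filter.1 hχ
    exact (hl χ hχl).resolve_left (of_decide_eq_true hχφ)
  · simp only [sentence_imp, sentence_impList]
    exact ⟨hs, fun χ hχ => hs.1 χ (List.mem_of_mem_filter hχ), hφ, hs.2⟩
  · simp only [hv.imp, hv.impList, List.mem_filter, decide_eq_true_eq]
    intro hlψ hfilter hvφ
    refine hlψ fun χ hχ => ?_
    rcases eq_or_ne χ φ with rfl | hχφ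
    exacts [hvφ, hfilter χ ⟨hχ, hχφ⟩]

theorem Derives.of_impList {l : List (Formula n Φ V)} (h : ℒ.Derives Γ (impList l φ))
    (hl : ∀ ψ ∈ l, ℒ.Derives Γ ψ) : ℒ.Derives Γ φ := by
  induction l with
  | nil => exact h
  | cons a l ih =>
    rw [List.forall_mem_cons] at hl
    exact ih (h.mp hl.1) hl.2

theorem Derives.to_impList {l : List (Formula n Φ V)} (hl : ∀ ψ ∈ l, ℒ.Sentence ψ)
    (h : ℒ.Derives (Γ ∪ {ψ | ψ ∈ l}) φ) : ℒ.Derives Γ (impList l φ) := by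
  induction l generalizing Γ with
  | nil => exact h.mono (by simp)
  | cons a l ih =>
    rw [List.forall_mem_cons] at hl
    refine Derives.deduction (ih hl.2 (h.mono ?_)) hl.1
    rintro ψ (hψ | hψ)
    · exact .inl (.inr hψ)
    · exact (List.mem_cons.1 hψ).imp .inl id

theorem Consistent.mono (h : ℒ.Consistent Δ) (hΓ : Γ ⊆ Δ) : ℒ.Consistent Γ :=
  fun φ h₁ h₂ => h φ (h₁.mono hΓ) (h₂.mono hΓ)

theorem derives_neg_of_not_consistent (h : ¬ ℒ.Consistent (insert φ Γ)) (hφ : ℒ.Sentence φ) :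
    ℒ.Derives Γ (neg φ) := by
  simp only [Consistent, not_forall, not_not] at h
  obtain ⟨ψ, h₁, h₂⟩ := h
  exact (h₁.deduction hφ).neg_of_imp (h₂.deduction hφ)

theorem derives_of_not_consistent_neg (h : ¬ ℒ.Consistent (insert (neg φ) Γ))
    (hφ : ℒ.Sentence φ) : ℒ.Derives Γ φ :=
  (derives_neg_of_not_consistent h hφ).of_neg_neg

theorem Consistent.insert_or (h : ℒ.Consistent Γ) (hφ : ℒ.Sentence φ) :
    ℒ.Consistent (insert φ Γ) ∨ ℒ.Consistent (insert (neg φ) Γ) := by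
  by_contra! h'
  exact h _ (derives_of_not_consistent_neg h'.2 hφ) (derives_neg_of_not_consistent h'.1 hφ)

theorem Consistent.of_finite
    (h : ∀ F : Finset (Formula n Φ V), (F : Set (Formula n Φ V)) ⊆ Γ →
      ℒ.Consistent (F : Set (Formula n Φ V))) :
    ℒ.Consistent Γ := by
  classical
  rintro φ ⟨l₁, hl₁, h₁⟩ ⟨l₂, hl₂, h₂⟩
  refine h (l₁ ++ l₂).toFinset (fun ψ hψ => ?_) φ ⟨l₁, fun ψ hψ => by simp [hψ], h₁⟩
    ⟨l₂, fun ψ hψ => by simp [hψ], h₂⟩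
  exact (List.mem_append.1 (List.mem_toFinset.1 hψ)).elim (hl₁ ψ) (hl₂ ψ)

end Fragment

namespace Fragment

variable {ℒ : Fragment} {Γ : Set (Formula n Φ V)} {φ ψ : Formula n Φ V} {i : Fin n}

/-! ### Derived rules for knowledge and quantifiers -/

theorem Derives.K_mp (h₁ : ℒ.Derives Γ (K i (imp φ ψ))) (h₂ : ℒ.Derives Γ (K i φ)) :
    ℒ.Derives Γ (K i ψ) :=
  (Proves.of_schemesK (.inl (.inl (.inl (.inl (.inr ⟨i, φ, ψ, rfl⟩)))))
    (sentence_imp.2 ⟨sentence_and.2 ⟨h₂.sentence, h₁.sentence⟩,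
      (sentence_imp.1 h₁.sentence).2⟩)).derives.mp (h₂.and_intro h₁)

theorem Derives.Astar_of_K (h : ℒ.Derives Γ (K i φ)) : ℒ.Derives Γ (Astar i φ) :=
  (Proves.of_schemesK (.inl (.inl (.inl (.inr ⟨i, φ, rfl⟩))))
    (sentence_imp.2 ⟨h.sentence, sentence_Astar.2 h.sentence⟩)).derives.mp h

theorem proves_axT (hφ : ℒ.Sentence φ) : ℒ.Proves (imp (K i φ) φ) :=
  .of_schemesK (.inl (.inl (.inr ⟨i, φ, rfl⟩))) (sentence_imp.2 ⟨hφ, hφ⟩)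

theorem Derives.of_K (h : ℒ.Derives Γ (K i φ)) : ℒ.Derives Γ φ :=
  (proves_axT (sentence_K.1 h.sentence)).derives.mp h

theorem Derives.neg_K (h : ℒ.Derives Γ (neg φ)) : ℒ.Derives Γ (neg (K i φ)) :=
  (proves_axT (sentence_neg.1 h.sentence)).derives.neg_of_imp (h.imp_of_right h.sentence)

theorem Derives.K_K (h : ℒ.Derives Γ (K i φ)) : ℒ.Derives Γ (K i (K i φ)) :=
  (Proves.of_schemesK (.inl (.inr ⟨i, φ, rfl⟩))
    (sentence_imp.2 ⟨h.sentence, h.sentence⟩)).derives.mp h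

theorem Derives.K_neg_K (h₁ : ℒ.Derives Γ (neg (K i φ))) (h₂ : ℒ.Derives Γ (Astar i φ)) :
    ℒ.Derives Γ (K i (neg (K i φ))) :=
  (Proves.of_schemesK (.inr ⟨i, φ, rfl⟩)
    (sentence_imp.2 ⟨sentence_and.2 ⟨h₁.sentence, h₂.sentence⟩, h₁.sentence⟩)).derives.mp
    (h₁.and_intro h₂)

theorem Derives.gen (h : ℒ.Proves φ) (h' : ℒ.Derives Γ (Astar i φ)) : ℒ.Derives Γ (K i φ) :=
  (Proves.derives (.genStar i h)).mp h'

theorem Derives.K_of_impList {l : List (Formula n Φ V)} (h : ℒ.Derives Γ (K i (impList l φ)))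
    (hl : ∀ ψ ∈ l, ℒ.Derives Γ (K i ψ)) : ℒ.Derives Γ (K i φ) := by
  induction l with
  | nil => exact h
  | cons a l ih =>
    rw [List.forall_mem_cons] at hl
    exact ih (h.K_mp hl.1) hl.2

theorem Derives.inst_all {x : V} {θ : Formula n Φ V} (h : ℒ.Derives Γ (all x φ))
    (hθ : θ ∈ ℒ.range) : ℒ.Derives Γ (φ.substVar x θ) :=
  (Proves.of_schemesAllK (sentence_all.1 h.sentence).1
    (.inl (.inl (.inl (.inl (.inr ⟨x, φ, θ, hθ.1, rfl⟩)))))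
    (sentence_imp.2 ⟨h.sentence, h.sentence.substVar hθ⟩)).derives.mp h

theorem Derives.all_mp {x : V} (h₁ : ℒ.Derives Γ (all x (imp φ ψ))) (h₂ : ℒ.Derives Γ (all x φ)) :
    ℒ.Derives Γ (all x ψ) := by
  obtain ⟨hq, hfree, hkOnly⟩ := sentence_all.1 h₁.sentence
  have hψ : ℒ.Sentence (all x ψ) :=
    sentence_all.2 ⟨hq, Set.subset_union_right.trans hfree, fun hk => (hkOnly hk).2⟩
  exact ((Proves.of_schemesAllK hq (.inl (.inl (.inl (.inr ⟨x, φ, ψ, rfl⟩))))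
    (sentence_imp.2 ⟨h₁.sentence, sentence_imp.2 ⟨h₂.sentence, hψ⟩⟩)).derives.mp h₁).mp h₂

theorem Derives.all_of_sentence (hq : ℒ.quant) (h : ℒ.Derives Γ φ) (x : V) :
    ℒ.Derives Γ (all x φ) := by
  have hfree : φ.free = ∅ := h.sentence.1
  have hall : ℒ.Sentence (all x φ) := sentence_all.2 ⟨hq, by simp [hfree], h.sentence.2.1⟩
  exact (Proves.of_schemesAllK hq (.inl (.inl (.inr ⟨x, φ, by simp [hfree], rfl⟩)))
    (sentence_imp.2 ⟨h.sentence, hall⟩)).derives.mp h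

theorem Derives.all_of_impList (hq : ℒ.quant) {l : List (Formula n Φ V)} {x : V}
    (hl : ∀ ψ ∈ l, ℒ.Derives Γ ψ) (h : ℒ.Derives Γ (all x (impList l φ))) :
    ℒ.Derives Γ (all x φ) := by
  induction l with
  | nil => exact h
  | cons a l ih =>
    rw [List.forall_mem_cons] at hl
    exact ih hl.2 (h.all_mp (hl.1.all_of_sentence hq x))

theorem Derives.generalize (hq : ℒ.quant) {x : V} {p : Φ} (hΓ : ∀ ψ ∈ Γ, p ∉ ψ.prims)
    (hx : φ.Substitutable x p) (h : ℒ.Derives Γ φ) :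
    ℒ.Derives Γ (all x (φ.substPrim p (var x))) := by
  obtain ⟨l, hl, h⟩ := h
  have hp : ∀ ψ ∈ l, p ∉ ψ.prims := fun ψ hψ => hΓ ψ (hl ψ hψ)
  have hg : ℒ.Proves (all x ((impList l φ).substPrim p (var x))) :=
    Provable.genAll hq x p (substitutable_impList hp hx) h
  rw [substPrim_impList hp] at hg
  exact hg.derives.all_of_impList hq fun ψ hψ =>
    .of_mem (hl ψ hψ) ((sentence_impList.1 h.sentence).1 ψ hψ)

theorem Derives.all_of_instance (hq : ℒ.quant) {x : V} {p : Φ} (hΓ : ∀ ψ ∈ Γ, p ∉ ψ.prims)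
    (hp : p ∉ φ.prims) (h : ℒ.Derives Γ (φ.substVar x (prim p))) : ℒ.Derives Γ (all x φ) := by
  have hgen := h.generalize hq hΓ (substitutable_substVar_prim x hp)
  rwa [substPrim_substVar_prim x hp] at hgen

/-! ### Awareness is generated by primitive propositions -/

theorem proves_verum [Nonempty Φ] (hq : ℒ.quant) (x : V) :
    ℒ.Proves (verum x : Formula n Φ V) := by
  obtain ⟨p⟩ := ‹Nonempty Φ›
  have h : ℒ.Proves (Formula.or (prim p) (neg (prim p)) : Formula n Φ V) :=
    .of_tautology (by simp) fun v hv => by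
      rw [hv.or, hv.neg]
      exact em _
  have hgen := Provable.genAll hq x p (by simp [Formula.or, Substitutable]) h
  simpa [Proves, verum, Formula.or, substPrim] using hgen

theorem derives_conj_iff [Nonempty Φ] {x : V} {l : List (Formula n Φ V)}
    (hl : ℒ.quant ∨ l ≠ []) : ℒ.Derives Γ (conj x l) ↔ ∀ ψ ∈ l, ℒ.Derives Γ ψ := by
  induction l using conj.induct with
  | case1 => simp [conj, (proves_verum (by simpa using hl) x).derives]
  | case2 a => simp [conj]
  | case3 a b l ih =>
    rw [conj, List.forall_mem_cons, ← ih (by simp)]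
    exact ⟨fun h => ⟨h.and_left, h.and_right⟩, fun h => h.1.and_intro h.2⟩

theorem Sentence.exists_enumeration (hφ : ℒ.Sentence φ) :
    ∃ l : List Φ, l.Nodup ∧ (∀ p, p ∈ l ↔ p ∈ φ.prims) ∧ (ℒ.quant ∨ l ≠ []) := by
  refine ⟨φ.finite_prims.toFinset.toList, Finset.nodup_toList _, by simp, ?_⟩
  by_cases hq : ℒ.quant
  · exact .inl hq
  · exact .inr (by simpa using (hφ.2.2 hq).prims_nonempty.ne_empty)

theorem derives_iff_forall_prims [Nonempty Φ] [Nonempty V] {O : Formula n Φ V → Formula n Φ V}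
    (hO : ∀ {ψ}, ℒ.Sentence ψ → ℒ.Sentence (O ψ)) (hφ : ℒ.Sentence φ)
    (hax : ∀ (l : List Φ) (x : V), l.Nodup → (∀ p, p ∈ l ↔ p ∈ φ.prims) →
      ℒ.Sentence (iff (O φ) (conj x (l.map fun p => O (prim p)))) →
      ℒ.Proves (iff (O φ) (conj x (l.map fun p => O (prim p))))) :
    ℒ.Derives Γ (O φ) ↔ ∀ p ∈ φ.prims, ℒ.Derives Γ (O (prim p)) := by
  obtain ⟨x⟩ := ‹Nonempty V›
  obtain ⟨l, hnodup, hl, hne⟩ := hφ.exists_enumeration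
  have hconj {Δ : Set (Formula n Φ V)} : ℒ.Derives Δ (conj x (l.map fun p => O (prim p))) ↔
      ∀ p ∈ φ.prims, ℒ.Derives Δ (O (prim p)) := by
    rw [derives_conj_iff (by simpa using hne)]
    simp [hl]
  have hs : ℒ.Sentence (conj x (l.map fun p => O (prim p))) :=
    (hconj.2 fun p _ => .of_mem (Set.mem_univ _) (hO (sentence_prim p))).sentence
  have hiff := hax l x hnodup hl (sentence_iff.2 ⟨hO hφ, hs⟩)
  rw [← hconj]
  exact ⟨hiff.derives.iff_mp, hiff.derives.iff_mpr⟩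

theorem derives_Astar_iff [Nonempty Φ] [Nonempty V] (hφ : ℒ.Sentence φ) :
    ℒ.Derives Γ (Astar i φ) ↔ ∀ p ∈ φ.prims, ℒ.Derives Γ (Astar i (prim p)) :=
  derives_iff_forall_prims sentence_Astar.2 hφ fun l x hnodup hl =>
    .of_schemesK (.inl (.inl (.inl (.inl (.inl (.inr ⟨i, φ, l, x, hnodup, hl, rfl⟩))))))

theorem derives_A_iff [Nonempty Φ] [Nonempty V] (hk : ¬ ℒ.kOnly) (hφ : ℒ.Sentence φ) :
    ℒ.Derives Γ (A i φ) ↔ ∀ p ∈ φ.prims, ℒ.Derives Γ (A i (prim p)) :=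
  derives_iff_forall_prims (fun hψ => sentence_A.2 ⟨hk, hψ⟩) hφ fun l x hnodup hl hs =>
    .ax ⟨.inr (.inr ⟨hk, .inl (.inl ⟨i, φ, l, x, hnodup, hl, rfl⟩)⟩), hs⟩

theorem Derives.K_A (h : ℒ.Derives Γ (A i φ)) : ℒ.Derives Γ (K i (A i φ)) :=
  (Proves.derives (.ax ⟨.inr (.inr ⟨(sentence_A.1 h.sentence).1, .inl (.inr ⟨i, φ, rfl⟩)⟩),
    sentence_imp.2 ⟨h.sentence, h.sentence⟩⟩)).mp h

theorem derives_X_iff (hk : ¬ ℒ.kOnly) (hφ : ℒ.Sentence φ) :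
    ℒ.Derives Γ (X i φ) ↔ ℒ.Derives Γ (K i φ) ∧ ℒ.Derives Γ (A i φ) := by
  have hax : ℒ.Derives Γ (iff (X i φ) (and (K i φ) (A i φ))) :=
    Proves.derives (.ax ⟨.inr (.inr ⟨hk, .inr ⟨i, φ, rfl⟩⟩), by
      simp [sentence_X, sentence_A, hk, hφ]⟩)
  exact ⟨fun h => ⟨(hax.iff_mp h).and_left, (hax.iff_mp h).and_right⟩,
    fun h => hax.iff_mpr (h.1.and_intro h.2)⟩

end Fragment

/-! ### The Barcan formula -/

/-- The formula `∀x A_i^* x`: agent `i` is aware of everything. -/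
def awareOfAll (i : Fin n) (x : V) : Formula n Φ V := all x (Astar i (var x))

/-- The formula `∀x ¬A_i^* x`: agent `i` is aware of nothing. -/
def awareOfNone (i : Fin n) (x : V) : Formula n Φ V := all x (neg (Astar i (var x)))

/-- The formula `∀x (A_i^* x ⇒ K_i φ)`: agent `i` knows `φ` of everything it is aware of. This is
the second premise of Barcan^*. -/
def knownOfAware (i : Fin n) (x : V) (φ : Formula n Φ V) : Formula n Φ V :=
  all x (imp (Astar i (var x)) (K i φ))

@[simp] theorem prims_awareOfAll (i : Fin n) (x : V) :
    (awareOfAll i x : Formula n Φ V).prims = ∅ := by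
  rw [awareOfAll, prims, prims_Astar, prims]

@[simp] theorem prims_awareOfNone (i : Fin n) (x : V) :
    (awareOfNone i x : Formula n Φ V).prims = ∅ := by
  rw [awareOfNone, prims, prims, prims_Astar, prims]

@[simp] theorem prims_knownOfAware (i : Fin n) (x : V) (φ : Formula n Φ V) :
    (knownOfAware i x φ).prims = φ.prims := by
  simp [knownOfAware, prims]

namespace Fragment

variable {ℒ : Fragment} {Γ : Set (Formula n Φ V)} {φ : Formula n Φ V} {i : Fin n} {x : V}

@[simp] theorem sentence_awareOfAll :
    ℒ.Sentence (awareOfAll i x : Formula n Φ V) ↔ ℒ.quant := by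
  simp [awareOfAll, sentence_all, Astar, Formula.or, free, KOnly]

@[simp] theorem sentence_awareOfNone :
    ℒ.Sentence (awareOfNone i x : Formula n Φ V) ↔ ℒ.quant := by
  simp [awareOfNone, sentence_all, Astar, Formula.or, free, KOnly]

@[simp] theorem sentence_knownOfAware :
    ℒ.Sentence (knownOfAware i x φ) ↔ ℒ.Sentence (all x φ) := by
  simp [knownOfAware, sentence_all, Astar, imp, Formula.or, free, KOnly]

theorem derives_Astar_substVar {p : Φ} (h : ℒ.Derives Γ (Astar i (all x φ)))
    (hp : ℒ.Derives Γ (Astar i (prim p))) :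
    ℒ.Derives Γ (Astar i (φ.substVar x (prim p))) := by
  have : Nonempty Φ := ⟨p⟩
  have : Nonempty V := ⟨x⟩
  have hs : ℒ.Sentence (all x φ) := sentence_Astar.1 h.sentence
  rw [derives_Astar_iff (hs.substVar (prim_mem_range p))]
  intro r hr
  rcases prims_substVar_subset x φ (prim p) hr with hr | rfl
  exacts [(derives_Astar_iff hs).1 h r hr, hp]

theorem proves_imp_not_knownOfAware (hs : ℒ.Sentence (all x φ)) (p : Φ) :
    ℒ.Proves (imp (Astar i (prim p))
      (imp (neg (K i (φ.substVar x (prim p)))) (neg (knownOfAware i x φ)))) := by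
  have hp := hs.substVar (prim_mem_range p)
  have hinst : ℒ.Proves (imp (knownOfAware i x φ)
      (imp (Astar i (prim p)) (K i (φ.substVar x (prim p))))) :=
    .of_schemesAllK (sentence_all.1 hs).1
      (.inl (.inl (.inl (.inl (.inr ⟨x, imp (Astar i (var x)) (K i φ), prim p, trivial, by
        simp [knownOfAware]⟩))))) (by simp [hs, hp])
  refine Proves.mp (.of_tautology (by simp [hs, hp]) fun v hv => ?_) hinst
  simp only [hv.imp, hv.neg]
  tauto

theorem derives_K_not_knownOfAware {p : Φ}
    (h : ℒ.Derives Γ (Astar i (all x φ))) (hp : ℒ.Derives Γ (Astar i (prim p)))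
    (hneg : ℒ.Derives Γ (neg (φ.substVar x (prim p)))) :
    ℒ.Derives Γ (K i (neg (knownOfAware i x φ))) := by
  have : Nonempty Φ := ⟨p⟩
  have : Nonempty V := ⟨x⟩
  have hs : ℒ.Sentence (all x φ) := sentence_Astar.1 h.sentence
  have hφp := derives_Astar_substVar h hp
  have himp := proves_imp_not_knownOfAware (i := i) hs p
  have haware : ℒ.Derives Γ (Astar i (imp (Astar i (prim p))
      (imp (neg (K i (φ.substVar x (prim p)))) (neg (knownOfAware i x φ))))) := by
    rw [derives_Astar_iff himp.sentence]
    simp only [prims_imp, prims_Astar, prims, prims_knownOfAware]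
    rintro r (rfl | hr | hr)
    exacts [hp, (derives_Astar_iff (sentence_neg.1 hneg.sentence)).1 hφp r hr,
      (derives_Astar_iff hs).1 h r hr]
  exact ((Derives.gen himp haware).K_mp hp.K_K).K_mp (hneg.neg_K.K_neg_K hφp)

theorem Derives.imp_substVar_of_not_K_not_knownOfAware {p : Φ}
    (hposs : ℒ.Derives Γ (neg (K i (neg (knownOfAware i x φ)))))
    (h : ℒ.Derives Γ (Astar i (all x φ))) :
    ℒ.Derives Γ (imp (Astar i (prim p)) (φ.substVar x (prim p))) := by
  have hs : ℒ.Sentence (φ.substVar x (prim p)) :=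
    (sentence_Astar.1 h.sentence).substVar (prim_mem_range p)
  refine .deduction (derives_of_not_consistent_neg (fun hcon => ?_) hs) (by simp)
  refine hcon _ (derives_K_not_knownOfAware (h.mono ?_) (.of_mem (.inr (.inl rfl)) (by simp))
    (.of_mem (.inl rfl) hs)) (hposs.mono ?_) <;>
  exact (Set.subset_insert _ _).trans (Set.subset_insert _ _)

end Fragment

/-! ### Worlds of the canonical structure -/

namespace Fragment

/-- The sentences of the fragment over the primitive propositions in `L`. -/
def sentencesOver (ℒ : Fragment) (L : Set Φ) : Set (Formula n Φ V) :=
  {φ | ℒ.Sentence φ ∧ φ.prims ⊆ L}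

variable {ℒ : Fragment} {L : Set Φ} {φ : Formula n Φ V} {x : V} {θ : Formula n Φ V}

@[simp] theorem neg_mem_sentencesOver :
    neg φ ∈ ℒ.sentencesOver L ↔ φ ∈ ℒ.sentencesOver L := by
  simp [sentencesOver, prims]

theorem substVar_mem_sentencesOver (h : all x φ ∈ ℒ.sentencesOver L) (hθ : θ ∈ ℒ.range)
    (hL : θ.prims ⊆ L) : φ.substVar x θ ∈ ℒ.sentencesOver L :=
  ⟨h.1.substVar hθ, (prims_substVar_subset x φ θ).trans (Set.union_subset h.2 hL)⟩

/-- The worlds of the canonical structure: maximal consistent sets of sentences over the primitive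
propositions in `L`, with a quantifier-free counterexample to every universal sentence that they
refute. Infinitely many primitive propositions are left over, for accessible worlds to draw on. -/
structure IsWorld (ℒ : Fragment) (L : Set Φ) (Γ : Set (Formula n Φ V)) : Prop where
  nonempty : L.Nonempty
  infinite_compl : Lᶜ.Infinite
  subset : Γ ⊆ ℒ.sentencesOver L
  mem_or : ∀ {φ}, φ ∈ ℒ.sentencesOver L → φ ∈ Γ ∨ neg φ ∈ Γ
  consistent : ℒ.Consistent Γ
  counterexample : ∀ {x φ}, neg (all x φ) ∈ Γ →
    ∃ θ ∈ ℒ.range, θ.prims ⊆ L ∧ neg (φ.substVar x θ) ∈ Γ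

namespace IsWorld

variable {Γ : Set (Formula n Φ V)} {φ ψ : Formula n Φ V} {i : Fin n}

theorem sentence (h : ℒ.IsWorld L Γ) (hφ : φ ∈ Γ) : ℒ.Sentence φ := (h.subset hφ).1

theorem prims_subset (h : ℒ.IsWorld L Γ) (hφ : φ ∈ Γ) : φ.prims ⊆ L := (h.subset hφ).2

theorem derives (h : ℒ.IsWorld L Γ) (hφ : φ ∈ Γ) : ℒ.Derives Γ φ := .of_mem hφ (h.sentence hφ)

theorem mem_of_derives (h : ℒ.IsWorld L Γ) (hφ : ℒ.Derives Γ φ) (hL : φ.prims ⊆ L) : φ ∈ Γ :=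
  (h.mem_or ⟨hφ.sentence, hL⟩).resolve_right fun hn => h.consistent φ hφ (h.derives hn)

theorem mem_iff_derives (h : ℒ.IsWorld L Γ) (hL : φ.prims ⊆ L) : φ ∈ Γ ↔ ℒ.Derives Γ φ :=
  ⟨h.derives, fun hφ => h.mem_of_derives hφ hL⟩

theorem neg_mem_iff (h : ℒ.IsWorld L Γ) (hφ : φ ∈ ℒ.sentencesOver L) : neg φ ∈ Γ ↔ φ ∉ Γ :=
  ⟨fun h₁ h₂ => h.consistent φ (h.derives h₂) (h.derives h₁), (h.mem_or hφ).resolve_left⟩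

theorem and_mem_iff (h : ℒ.IsWorld L Γ) : and φ ψ ∈ Γ ↔ φ ∈ Γ ∧ ψ ∈ Γ := by
  refine ⟨fun hm => ?_, fun hm => ?_⟩
  · have hL := Set.union_subset_iff.1 (h.prims_subset hm)
    exact ⟨h.mem_of_derives (h.derives hm).and_left hL.1,
      h.mem_of_derives (h.derives hm).and_right hL.2⟩
  · exact h.mem_of_derives ((h.derives hm.1).and_intro (h.derives hm.2))
      (Set.union_subset (h.prims_subset hm.1) (h.prims_subset hm.2))

theorem imp_mem (h : ℒ.IsWorld L Γ) (hφ : φ ∈ ℒ.sentencesOver L) (hψ : ψ ∈ ℒ.sentencesOver L)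
    (himp : φ ∈ Γ → ψ ∈ Γ) : imp φ ψ ∈ Γ := by
  have hL : (imp φ ψ).prims ⊆ L := by
    rw [prims_imp]
    exact Set.union_subset hφ.2 hψ.2
  rcases h.mem_or hφ with hm | hm
  · exact h.mem_of_derives ((h.derives (himp hm)).imp_of_right hφ.1) hL
  · exact h.mem_of_derives ((h.derives hm).imp_of_neg hψ.1) hL

theorem all_mem_iff (h : ℒ.IsWorld L Γ) {x : V} (hφ : all x φ ∈ ℒ.sentencesOver L) :
    all x φ ∈ Γ ↔ ∀ θ ∈ ℒ.range, θ.prims ⊆ L → φ.substVar x θ ∈ Γ := by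
  refine ⟨fun hm θ hθ hθL => ?_, fun hall => (h.mem_or hφ).resolve_right fun hn => ?_⟩
  · exact h.mem_of_derives ((h.derives hm).inst_all hθ) (substVar_mem_sentencesOver hφ hθ hθL).2
  · obtain ⟨θ, hθ, hθL, hm⟩ := h.counterexample hn
    exact h.consistent _ (h.derives (hall θ hθ hθL)) (h.derives hm)

theorem of_K_mem (h : ℒ.IsWorld L Γ) (hm : K i φ ∈ Γ) : φ ∈ Γ :=
  h.mem_of_derives (h.derives hm).of_K (h.prims_subset hm :)

theorem K_K_mem (h : ℒ.IsWorld L Γ) (hm : K i φ ∈ Γ) : K i (K i φ) ∈ Γ :=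
  h.mem_of_derives (h.derives hm).K_K (h.prims_subset hm :)

theorem Astar_mem_of_K_mem (h : ℒ.IsWorld L Γ) (hm : K i φ ∈ Γ) : Astar i φ ∈ Γ :=
  h.mem_of_derives (h.derives hm).Astar_of_K (by rw [prims_Astar]; exact (h.prims_subset hm :))

theorem K_neg_K_mem (h : ℒ.IsWorld L Γ) (hm : neg (K i φ) ∈ Γ) (hA : Astar i φ ∈ Γ) :
    K i (neg (K i φ)) ∈ Γ :=
  h.mem_of_derives ((h.derives hm).K_neg_K (h.derives hA)) (h.prims_subset hm :)

theorem K_A_mem (h : ℒ.IsWorld L Γ) (hm : A i φ ∈ Γ) : K i (A i φ) ∈ Γ :=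
  h.mem_of_derives (h.derives hm).K_A (h.prims_subset hm :)

theorem A_mem_iff [Nonempty V] (h : ℒ.IsWorld L Γ) (hA : ℒ.Sentence (A i φ)) :
    A i φ ∈ Γ ↔ ∀ p ∈ φ.prims, A i (prim p) ∈ Γ := by
  have : Nonempty Φ := h.nonempty.to_type
  obtain ⟨hk, hφ⟩ := sentence_A.1 hA
  refine ⟨fun hm p hp => ?_, fun hall => ?_⟩
  · exact h.mem_of_derives ((derives_A_iff hk hφ).1 (h.derives hm) p hp)
      (Set.singleton_subset_iff.2 (h.prims_subset hm hp))
  · exact h.mem_of_derives ((derives_A_iff hk hφ).2 fun p hp => h.derives (hall p hp))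
      fun p hp => h.prims_subset (hall p hp) rfl

theorem X_mem_iff (h : ℒ.IsWorld L Γ) (hX : X i φ ∈ ℒ.sentencesOver L) :
    X i φ ∈ Γ ↔ K i φ ∈ Γ ∧ A i φ ∈ Γ := by
  obtain ⟨hk, hφ⟩ := sentence_X.1 hX.1
  rw [h.mem_iff_derives hX.2, h.mem_iff_derives (φ := K i φ) hX.2,
    h.mem_iff_derives (φ := A i φ) hX.2, derives_X_iff hk hφ]

end IsWorld

end Fragment

/-! ### Existence of worlds -/

theorem exists_directed_union {α ι : Type*} [Countable ι] {C : Set (Finset α)} {F₀ : Finset α}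
    (h₀ : F₀ ∈ C) {D : ι → Set (Finset α)}
    (hD : ∀ j, ∀ F ∈ C, ∃ F' ∈ C, F ⊆ F' ∧ F' ∈ D j) :
    ∃ Γ : Set α, (F₀ : Set α) ⊆ Γ ∧
      (∀ F : Finset α, (F : Set α) ⊆ Γ → ∃ F' ∈ C, F ⊆ F') ∧
      ∀ j, ∃ F ∈ D j, (F : Set α) ⊆ Γ := by
  classical
  have : Encodable ι := Encodable.ofCountable ι
  let cofinals (j : ι) : Order.Cofinal C :=
    { carrier := {F | F.1 ∈ D j}
      isCofinal := fun F =>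
        let ⟨F', hF', hsub, hj⟩ := hD j F.1 F.2
        ⟨⟨F', hF'⟩, hj, hsub⟩ }
  let I := Order.idealOfCofinals (⟨F₀, h₀⟩ : C) cofinals
  refine ⟨{a | ∃ F ∈ I, a ∈ F.1}, fun a ha => ⟨_, Order.mem_idealOfCofinals _ _, ha⟩,
    fun F hF => ?_, fun j => ?_⟩
  · obtain ⟨F', -, hF'⟩ : ∃ F' ∈ I, F ⊆ F'.1 := by
      induction F using Finset.induction_on with
      | empty => exact ⟨_, Order.mem_idealOfCofinals _ _, Finset.empty_subset _⟩
      | insert a F _ ih =>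
        rw [Finset.coe_insert, Set.insert_subset_iff] at hF
        obtain ⟨F₁, hF₁, ha⟩ := hF.1
        obtain ⟨F₂, hF₂, hs⟩ := ih hF.2
        obtain ⟨F₃, hF₃, h₁, h₂⟩ := I.directed F₁ hF₁ F₂ hF₂
        exact ⟨F₃, hF₃, Finset.insert_subset (h₁ ha) (hs.trans h₂)⟩
    exact ⟨F', F'.2, hF'⟩
  · obtain ⟨F, hF, hI⟩ := Order.cofinal_meets_idealOfCofinals (⟨F₀, h₀⟩ : C) cofinals j
    exact ⟨F.1, hF, fun a ha => ⟨F, hI, ha⟩⟩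

namespace Fragment

variable {ℒ : Fragment} {L : Set Φ} {B Γ : Set (Formula n Φ V)} {φ : Formula n Φ V}

/-- A consistency property over `L` relative to a set `B` of sentences: a family of finite sets of
sentences that are consistent with `B` and can be enlarged within the family so as to decide a
sentence or to contain a counterexample. A world containing `B` is a union of members. -/
structure IsConsistencyProperty (ℒ : Fragment) (L : Set Φ) (B : Set (Formula n Φ V))
    (C : Set (Finset (Formula n Φ V))) : Prop where
  base_subset : B ⊆ ℒ.sentencesOver L
  subset : ∀ F ∈ C, (F : Set (Formula n Φ V)) ⊆ ℒ.sentencesOver L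
  consistent : ∀ F ∈ C, ℒ.Consistent (B ∪ F)
  decide : ∀ F ∈ C, ∀ φ ∈ ℒ.sentencesOver L, ∃ F' ∈ C, F ⊆ F' ∧ (φ ∈ F' ∨ neg φ ∈ F')
  counterexample : ∀ F ∈ C, ∀ x φ, neg (all x φ) ∈ F →
    ∃ F' ∈ C, F ⊆ F' ∧ ∃ θ ∈ ℒ.range, θ.prims ⊆ L ∧ neg (φ.substVar x θ) ∈ F'

namespace IsConsistencyProperty

variable {C : Set (Finset (Formula n Φ V))} {F : Finset (Formula n Φ V)}

theorem exists_decision (h : ℒ.IsConsistencyProperty L B C) (hF : F ∈ C)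
    (hφ : φ ∈ ℒ.sentencesOver L) :
    ∃ F' ∈ C, F ⊆ F' ∧ (φ ∈ F' ∨ neg φ ∈ F' ∧ ∀ x ψ, φ = all x ψ →
      ∃ θ ∈ ℒ.range, θ.prims ⊆ L ∧ neg (ψ.substVar x θ) ∈ F') := by
  obtain ⟨F₁, hF₁, hsub₁, hm | hm⟩ := h.decide F hF φ hφ
  · exact ⟨F₁, hF₁, hsub₁, .inl hm⟩
  by_cases hall : ∃ x ψ, φ = all x ψ
  · obtain ⟨x, ψ, rfl⟩ := hall
    obtain ⟨F₂, hF₂, hsub₂, hθ⟩ := h.counterexample F₁ hF₁ x ψ hm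
    refine ⟨F₂, hF₂, hsub₁.trans hsub₂, .inr ⟨hsub₂ hm, ?_⟩⟩
    rintro _ _ ⟨⟩
    exact hθ
  · exact ⟨F₁, hF₁, hsub₁, .inr ⟨hm, fun x ψ hψ => (hall ⟨x, ψ, hψ⟩).elim⟩⟩

theorem exists_isWorld [Countable Φ] [Countable V] (h : ℒ.IsConsistencyProperty L B C)
    (hF : F ∈ C) (hne : L.Nonempty) (hco : Lᶜ.Infinite) :
    ∃ Γ, ℒ.IsWorld L Γ ∧ B ⊆ Γ ∧ (F : Set (Formula n Φ V)) ⊆ Γ ∧ ∀ φ ∈ Γ, ∃ F' ∈ C, φ ∈ F' := by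
  classical
  obtain ⟨Γ, hFΓ, hfin, hmeets⟩ := exists_directed_union hF
    fun (φ : ℒ.sentencesOver (n := n) (V := V) L) F hF => h.exists_decision hF φ.2
  have hmem (φ) (hφ : φ ∈ Γ) : ∃ F' ∈ C, φ ∈ F' := by
    simpa using hfin {φ} (by simpa using hφ)
  have hsub : Γ ⊆ ℒ.sentencesOver L := fun φ hφ =>
    let ⟨F', hF', hm⟩ := hmem φ hφ
    h.subset F' hF' hm
  have hcon : ℒ.Consistent Γ := .of_finite fun F hF =>
    let ⟨F', hF', hs⟩ := hfin F hF
    (h.consistent F' hF').mono fun _ hφ => .inr (hs hφ)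
  refine ⟨Γ, ⟨hne, hco, hsub, fun {φ} hφ => ?_, hcon, fun {x φ} hm => ?_⟩, fun φ hφ => ?_,
    hFΓ, hmem⟩
  · obtain ⟨F', hF', hs⟩ := hmeets ⟨φ, hφ⟩
    exact hF'.imp (fun hm => hs hm) fun hm => hs hm.1
  · have hall : all x φ ∈ ℒ.sentencesOver L := neg_mem_sentencesOver.1 (hsub hm)
    obtain ⟨F', hm' | ⟨-, hθ⟩, hs⟩ := hmeets ⟨_, hall⟩
    · exact (hcon _ (.of_mem (hs hm') hall.1) (.of_mem hm hall.1)).elim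
    · obtain ⟨θ, hθ, hθL, hm'⟩ := hθ x φ rfl
      exact ⟨θ, hθ, hθL, hs hm'⟩
  · have hs := h.base_subset hφ
    obtain ⟨F', hm | ⟨hm, -⟩, hF'⟩ := hmeets ⟨φ, hs⟩
    · exact hF' hm
    · obtain ⟨F'', hF'', hm'⟩ := hmem _ (hF' hm)
      exact (h.consistent F'' hF'' φ (.of_mem (.inl hφ) hs.1) (.of_mem (.inr hm') hs.1)).elim

end IsConsistencyProperty

end Fragment

theorem exists_infinite_subset_diff {s : Set Φ} (hs : s.Infinite) :
    ∃ t ⊆ s, t.Infinite ∧ (s \ t).Infinite := by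
  obtain ⟨t, u, htu, hdisj, hcard⟩ := hs.exists_union_disjoint_cardinal_eq_of_infinite
  obtain ⟨e⟩ := Cardinal.eq.1 hcard
  have htu' : t.Finite ↔ u.Finite := e.finite_iff
  have ht : t.Infinite := fun ht => hs (htu ▸ ht.union (htu'.1 ht))
  refine ⟨t, htu ▸ Set.subset_union_left, ht, fun hu => ht (htu'.2 (hu.subset ?_))⟩
  exact fun p hp => ⟨htu ▸ .inr hp, fun hpt => Set.disjoint_left.1 hdisj hpt hp⟩

theorem exists_fresh_prim {s : Set Φ} (hs : s.Infinite) (F : Finset (Formula n Φ V)) :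
    ∃ p ∈ s, ∀ φ ∈ F, p ∉ φ.prims := by
  have hfin : (⋃ φ ∈ F, φ.prims).Finite := F.finite_toSet.biUnion fun φ _ => φ.finite_prims
  obtain ⟨p, hps, hp⟩ := (hs.sdiff hfin).nonempty
  exact ⟨p, hps, by simpa using hp⟩

namespace Fragment

variable {ℒ : Fragment} {L : Set Φ} {B Γ : Set (Formula n Φ V)} {φ : Formula n Φ V} {x : V}

theorem not_derives_substVar_of_neg_all_mem {p : Φ} (hcon : ℒ.Consistent Γ)
    (hs : ℒ.Sentence (all x φ)) (hm : neg (all x φ) ∈ Γ) (hp : ∀ ψ ∈ Γ, p ∉ ψ.prims) :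
    ¬ ℒ.Derives Γ (φ.substVar x (prim p)) := fun h =>
  hcon (all x φ) (h.all_of_instance (sentence_all.1 hs).1 hp (hp (neg (all x φ)) hm))
    (.of_mem hm hs)

theorem isConsistencyProperty_consistent (hB : B ⊆ ℒ.sentencesOver L)
    (hnew : ℒ.quant → {p ∈ L | ∀ ψ ∈ B, p ∉ ψ.prims}.Infinite) :
    ℒ.IsConsistencyProperty L B
      {F | (F : Set (Formula n Φ V)) ⊆ ℒ.sentencesOver L ∧ ℒ.Consistent (B ∪ F)} := by
  classical
  have insert_mem (F : Finset (Formula n Φ V)) (φ : Formula n Φ V)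
      (hF : (F : Set (Formula n Φ V)) ⊆ ℒ.sentencesOver L) (hφ : φ ∈ ℒ.sentencesOver L)
      (hcon : ℒ.Consistent (insert φ (B ∪ F))) :
      insert φ F ∈ {F : Finset (Formula n Φ V) |
        (F : Set (Formula n Φ V)) ⊆ ℒ.sentencesOver L ∧ ℒ.Consistent (B ∪ F)} := by
    rw [Set.mem_ofPred_eq, Finset.coe_insert, Set.union_insert]
    exact ⟨Set.insert_subset hφ hF, hcon⟩
  refine ⟨hB, fun F hF => hF.1, fun F hF => hF.2, fun F hF φ hφ => ?_, fun F hF x φ hm => ?_⟩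
  · rcases hF.2.insert_or hφ.1 with hc | hc
    · exact ⟨_, insert_mem F φ hF.1 hφ hc, Finset.subset_insert _ _,
        .inl (Finset.mem_insert_self _ _)⟩
    · exact ⟨_, insert_mem F (neg φ) hF.1 (neg_mem_sentencesOver.2 hφ) hc,
        Finset.subset_insert _ _, .inr (Finset.mem_insert_self _ _)⟩
  · have hall : all x φ ∈ ℒ.sentencesOver L := neg_mem_sentencesOver.1 (hF.1 hm)
    obtain ⟨p, ⟨hpL, hpB⟩, hpF⟩ := exists_fresh_prim (hnew (sentence_all.1 hall.1).1) F
    have hpL : (prim p : Formula n Φ V).prims ⊆ L := Set.singleton_subset_iff.2 hpL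
    have hφp := substVar_mem_sentencesOver hall (prim_mem_range p) hpL
    refine ⟨_, insert_mem F (neg (φ.substVar x (prim p))) hF.1 (neg_mem_sentencesOver.2 hφp) ?_,
      Finset.subset_insert _ _, prim p, prim_mem_range p, hpL, Finset.mem_insert_self _ _⟩
    refine not_imp_comm.1 (derives_of_not_consistent_neg · hφp.1) ?_
    exact not_derives_substVar_of_neg_all_mem hF.2 hall.1 (.inr hm) fun ψ hψ =>
      hψ.elim (hpB ψ) (hpF ψ)

theorem exists_isWorld_of_consistent [Countable Φ] [Countable V] (hne : L.Nonempty)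
    (hco : Lᶜ.Infinite) (hB : B ⊆ ℒ.sentencesOver L) (hcon : ℒ.Consistent B)
    (hnew : ℒ.quant → {p ∈ L | ∀ ψ ∈ B, p ∉ ψ.prims}.Infinite) :
    ∃ Γ, ℒ.IsWorld L Γ ∧ B ⊆ Γ := by
  obtain ⟨Γ, hΓ, hBΓ, -⟩ := (isConsistencyProperty_consistent hB hnew).exists_isWorld (F := ∅)
    ⟨by simp, by simpa using hcon⟩ hne hco
  exact ⟨Γ, hΓ, hBΓ⟩

theorem consistent_singleton_neg (hs : ℒ.Sentence φ) (hφ : ¬ ℒ.Proves φ) :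
    ℒ.Consistent {neg φ} := by
  by_contra hcon
  rw [← insert_empty_eq] at hcon
  obtain ⟨l, hl, h⟩ := derives_of_not_consistent_neg hcon hs
  rw [List.eq_nil_iff_forall_not_mem.2 hl] at h
  exact hφ h

theorem exists_isWorld_of_not_proves [Countable Φ] [Infinite Φ] [Countable V]
    (hs : ℒ.Sentence φ) (hφ : ¬ ℒ.Proves φ) :
    ∃ L Γ, ℒ.IsWorld L Γ ∧ φ.prims ⊆ L ∧ φ ∉ Γ := by
  obtain ⟨t, htφ, ht, htco⟩ := exists_infinite_subset_diff φ.finite_prims.infinite_compl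
  have hφL : φ ∈ ℒ.sentencesOver (φ.prims ∪ t) := ⟨hs, Set.subset_union_left⟩
  obtain ⟨Γ, hΓ, hm⟩ := exists_isWorld_of_consistent (ht.nonempty.mono Set.subset_union_right)
    (htco.mono fun p hp => not_or.2 hp) (Set.singleton_subset_iff.2 (neg_mem_sentencesOver.2 hφL))
    (consistent_singleton_neg hs hφ)
    fun _ => ht.mono fun p hp => ⟨.inr hp, by simpa [prims] using htφ hp⟩
  exact ⟨_, Γ, hΓ, hφL.2, (hΓ.neg_mem_iff hφL).1 (hm rfl)⟩

end Fragment

/-! ### What an agent knows -/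

/-- The sentences that agent `i` knows. -/
def known (i : Fin n) (Γ : Set (Formula n Φ V)) : Set (Formula n Φ V) := {φ | K i φ ∈ Γ}

/-- The primitive propositions that agent `i` is aware of, in the sense of `A_i^*`: they are
defined in all worlds that `i` considers possible. -/
def awarePrims (i : Fin n) (Γ : Set (Formula n Φ V)) : Set Φ := {p | Astar i (prim p) ∈ Γ}

namespace Fragment.IsWorld

variable {ℒ : Fragment} {L L' : Set Φ} {Γ Γ' : Set (Formula n Φ V)} {φ : Formula n Φ V}
  {i : Fin n}

theorem awarePrims_subset (h : ℒ.IsWorld L Γ) : awarePrims i Γ ⊆ L := fun p hp =>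
  h.prims_subset hp (by simp [prims])

theorem known_subset (h : ℒ.IsWorld L Γ) : known i Γ ⊆ Γ := fun _ => h.of_K_mem

theorem consistent_known (h : ℒ.IsWorld L Γ) : ℒ.Consistent (known i Γ) :=
  h.consistent.mono h.known_subset

theorem derives_known (h : ℒ.IsWorld L Γ) (hφ : K i φ ∈ Γ) : ℒ.Derives (known i Γ) φ :=
  .of_mem hφ (sentence_K.1 (h.sentence hφ))

section

variable [Nonempty V]

theorem Astar_mem_iff (h : ℒ.IsWorld L Γ) (hφ : ℒ.Sentence φ) :
    Astar i φ ∈ Γ ↔ φ.prims ⊆ awarePrims i Γ := by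
  have : Nonempty Φ := h.nonempty.to_type
  refine ⟨fun hm p hp => ?_, fun hA => ?_⟩
  · refine h.mem_of_derives ((derives_Astar_iff hφ).1 (h.derives hm) p hp) ?_
    simpa [prims] using h.prims_subset hm (by simpa using hp)
  · refine h.mem_of_derives ((derives_Astar_iff hφ).2 fun p hp => h.derives (hA hp)) ?_
    simpa using hA.trans h.awarePrims_subset

theorem known_subset_sentencesOver (h : ℒ.IsWorld L Γ) :
    known i Γ ⊆ ℒ.sentencesOver (awarePrims i Γ) := fun _ hφ =>
  have hs := sentence_K.1 (h.sentence hφ)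
  ⟨hs, (h.Astar_mem_iff hs).1 (h.Astar_mem_of_K_mem hφ)⟩

theorem K_mem_of_derives_known (h : ℒ.IsWorld L Γ) (hφ : ℒ.Derives (known i Γ) φ)
    (hA : φ.prims ⊆ awarePrims i Γ) : K i φ ∈ Γ := by
  obtain ⟨l, hl, hproves⟩ := hφ
  have haware : Astar i (impList l φ) ∈ Γ := by
    rw [h.Astar_mem_iff hproves.sentence, prims_impList_subset]
    exact ⟨fun ψ hψ => (h.known_subset_sentencesOver (hl ψ hψ)).2, hA⟩
  exact h.mem_of_derives ((Derives.gen hproves (h.derives haware)).K_of_impList fun ψ hψ =>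
    h.derives (hl ψ hψ)) (hA.trans h.awarePrims_subset)

theorem consistent_insert_neg_known (h : ℒ.IsWorld L Γ)
    (hφ : φ ∈ ℒ.sentencesOver (awarePrims i Γ)) (hK : K i φ ∉ Γ) :
    ℒ.Consistent (insert (neg φ) (known i Γ)) :=
  by_contra fun hcon =>
    hK (h.K_mem_of_derives_known (derives_of_not_consistent_neg hcon hφ.1) hφ.2)

theorem K_mem_iff_of_known_subset (h : ℒ.IsWorld L Γ) (h' : ℒ.IsWorld L' Γ')
    (hknown : known i Γ ⊆ Γ') (hA : awarePrims i Γ' ⊆ awarePrims i Γ) (φ : Formula n Φ V) :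
    K i φ ∈ Γ ↔ K i φ ∈ Γ' := by
  refine ⟨fun hm => hknown (h.K_K_mem hm), fun hm' => by_contra fun hm => ?_⟩
  obtain ⟨hs, hφ⟩ := h'.known_subset_sentencesOver hm'
  have hneg : neg (K i φ) ∈ Γ :=
    (h.neg_mem_iff (φ := K i φ) ⟨hs, (hφ.trans hA).trans h.awarePrims_subset⟩).2 hm
  have hneg' := hknown (h.K_neg_K_mem hneg ((h.Astar_mem_iff hs).2 (hφ.trans hA)))
  exact h'.consistent _ (h'.derives hm') (h'.derives hneg')

end

/-! ### Instances by new primitive propositions -/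

variable {y : V} {p : Φ}

theorem knownOfAware_mem (h : ℒ.IsWorld L Γ) (hφ : all y φ ∈ ℒ.sentencesOver (awarePrims i Γ))
    (hinst : ∀ θ ∈ ℒ.range, θ.prims ⊆ awarePrims i Γ →
      ℒ.Derives (known i Γ) (φ.substVar y θ)) :
    knownOfAware i y φ ∈ Γ := by
  have : Nonempty V := ⟨y⟩
  have hφL : all y φ ∈ ℒ.sentencesOver L := ⟨hφ.1, hφ.2.trans h.awarePrims_subset⟩
  have hs : ℒ.Sentence (knownOfAware i y φ) := sentence_knownOfAware.2 hφ.1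
  rw [knownOfAware, h.all_mem_iff ⟨hs, (prims_knownOfAware i y φ).trans_subset hφL.2⟩]
  intro θ hθ hθL
  simp only [substVar_imp, substVar_Astar, substVar_var_self, substVar_K]
  have hθs := sentence_of_mem_range hθ
  have hφθ := substVar_mem_sentencesOver hφL hθ hθL
  refine h.imp_mem ⟨sentence_Astar.2 hθs, by rwa [prims_Astar]⟩ ⟨sentence_K.2 hφθ.1, hφθ.2⟩
    fun hA => ?_
  have hθA := (h.Astar_mem_iff hθs).1 hA
  exact h.K_mem_of_derives_known (hinst θ hθ hθA) (substVar_mem_sentencesOver hφ hθ hθA).2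

theorem derives_imp_substVar_prim_of_aware (h : ℒ.IsWorld L Γ)
    (hφ : all y φ ∈ ℒ.sentencesOver (awarePrims i Γ))
    (hinst : ∀ θ ∈ ℒ.range, θ.prims ⊆ awarePrims i Γ →
      ℒ.Derives (known i Γ) (φ.substVar y θ)) :
    ℒ.Derives (known i Γ) (imp (Astar i (prim p)) (φ.substVar y (prim p))) := by
  have : Nonempty V := ⟨y⟩
  have hm := h.knownOfAware_mem hφ hinst
  have hs := h.sentence hm
  have hneg : neg (knownOfAware i y φ) ∈ ℒ.sentencesOver (awarePrims i Γ) :=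
    ⟨sentence_neg.2 hs, (prims_knownOfAware i y φ).trans_subset hφ.2⟩
  have hposs : neg (K i (neg (knownOfAware i y φ))) ∈ Γ :=
    (h.neg_mem_iff (φ := K i (neg (knownOfAware i y φ))) ⟨hs, (h.prims_subset hm :)⟩).2 fun hK =>
      h.consistent _ (h.derives hm) (h.derives (h.of_K_mem hK))
  have hKposs := h.K_neg_K_mem hposs ((h.Astar_mem_iff hneg.1).2 hneg.2)
  exact (h.derives_known hKposs).imp_substVar_of_not_K_not_knownOfAware
    (h.derives_known (h.K_K_mem (φ := Formula.or (all y φ) (neg (all y φ)))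
      ((h.Astar_mem_iff hφ.1).2 hφ.2)))

variable [Infinite V]

theorem derives_imp_substVar_prim (h : ℒ.IsWorld L Γ) (hs : ℒ.Sentence (all y φ))
    (hinst : ∀ θ ∈ ℒ.range, θ.prims ⊆ awarePrims i Γ →
      ℒ.Derives (known i Γ) (φ.substVar y θ)) (hp : p ∉ φ.prims) :
    ℒ.Derives (known i Γ) (imp (Astar i (prim p)) (φ.substVar y (prim p))) := by
  obtain ⟨T, hT⟩ : ∃ T : Finset Φ, φ.prims \ awarePrims i Γ = T :=
    (φ.finite_prims.sdiff).exists_finset_coe.imp fun _ => Eq.symm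
  classical
  induction T using Finset.induction_on generalizing φ with
  | empty =>
    rw [Finset.coe_empty, Set.sdiff_eq_empty] at hT
    exact h.derives_imp_substVar_prim_of_aware ⟨hs, hT⟩ hinst
  | insert r T hrT ih =>
    obtain ⟨hrφ, hr⟩ : r ∈ φ.prims \ awarePrims i Γ := hT ▸ Finset.mem_insert_self r T
    have hrp : r ∉ (prim p : Formula n Φ V).prims := fun hrp => hp (hrp ▸ hrφ)
    obtain ⟨hq, -⟩ := sentence_all.1 hs
    -- `r`, of which `i` is unaware, is generalized to a fresh variable `z`.
    obtain ⟨z, hz⟩ := (φ.finite_vars.insert y).infinite_compl.nonempty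
    obtain ⟨hzy, hzφ⟩ := not_or.1 hz
    have hzvars {θ : Formula n Φ V} (hθ : θ.QuantFree) : z ∉ (φ.substVar y θ).vars :=
      fun hm => hzφ (vars_substVar_subset hθ y φ hm)
    have hall := ih (φ := all z (φ.substPrim r (var z))) (hs.all_all_substPrim z r)
      (fun θ hθ hθA => ?_) (by simp [prims, prims_substPrim_var, hp]) ?_
    · rw [substVar_all_substPrim hzy hrp] at hall
      refine .deduction ?_ (by simp)
      have hinst' := ((hall.mono (Set.subset_insert (Astar i (prim p)) _)).mp
        (.of_mem (.inl rfl) (by simp))).inst_all (prim_mem_range r)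
      rwa [substVar_substPrim_var r (hzvars (θ := prim p) trivial)] at hinst'
    · rw [substVar_all_substPrim hzy fun hrθ => hr (hθA hrθ)]
      exact (hinst θ hθ hθA).generalize hq
        (fun ψ hψ hrψ => hr ((h.known_subset_sentencesOver hψ).2 hrψ))
        (substitutable_of_notMem_vars r (hzvars hθ.1))
    · rw [prims, prims_substPrim_var, Set.sdiff_sdiff_comm, hT, Finset.coe_insert,
        Set.insert_sdiff_self_of_notMem hrT]

theorem derives_union_imp_substVar_prim {F : Finset (Formula n Φ V)}
    (h : ℒ.IsWorld L Γ) (hF : ∀ ψ ∈ F, ℒ.Sentence ψ) (hs : ℒ.Sentence (all y φ))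
    (hinst : ∀ θ ∈ ℒ.range, θ.prims ⊆ awarePrims i Γ →
      ℒ.Derives (known i Γ ∪ F) (φ.substVar y θ))
    (hpF : ∀ ψ ∈ F, p ∉ ψ.prims) (hp : p ∉ φ.prims) :
    ℒ.Derives (known i Γ ∪ F) (imp (Astar i (prim p)) (φ.substVar y (prim p))) := by
  simp only [← F.mem_toList] at hF hpF
  have hmem {ψ : Formula n Φ V} : ψ ∈ F ↔ ψ ∈ F.toList := F.mem_toList.symm
  have hpl : p ∉ (impList F.toList φ).prims := by
    rw [← Set.subset_compl_singleton_iff, prims_impList_subset]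
    simp only [Set.subset_compl_singleton_iff]
    exact ⟨hpF, hp⟩
  have hl := h.derives_imp_substVar_prim (hs.all_impList hF) (i := i) (fun θ hθ hθA => ?_) hpl
  · rw [substVar_impList fun ψ hψ => (hF ψ hψ).1] at hl
    have hinst' : ℒ.Derives (insert (Astar i (prim p)) (known i Γ ∪ F))
        (impList F.toList (φ.substVar y (prim p))) :=
      (hl.mono (Set.subset_union_left.trans (Set.subset_insert _ _))).mp
        (.of_mem (.inl rfl) (by simp))
    exact (hinst'.of_impList fun ψ hψ =>
      .of_mem (.inr (.inr (hmem.2 hψ))) (hF ψ hψ)).deduction (by simp)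
  · rw [substVar_impList fun ψ hψ => (hF ψ hψ).1]
    exact .to_impList hF ((hinst θ hθ hθA).mono
      (Set.union_subset_union_right _ fun ψ hψ => hmem.1 hψ))

end Fragment.IsWorld

/-! ### Accessible worlds -/

namespace Fragment

/-- A stage in the construction of a world over `awarePrims i Γ ∪ Q` that `i` considers possible
in `Γ`: a finite set of sentences, consistent with what `i` knows, according to which `i` is unaware
of the primitive propositions of `Q` that occur in it. The set `Q` has to be empty or infinite
depending on whether `i` is to be aware of everything. -/
structure IsStage (ℒ : Fragment) (i : Fin n) (x : V) (Γ : Set (Formula n Φ V)) (Q : Set Φ)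
    (F : Finset (Formula n Φ V)) : Prop where
  subset : (F : Set (Formula n Φ V)) ⊆ ℒ.sentencesOver (awarePrims i Γ ∪ Q)
  consistent : ℒ.Consistent (known i Γ ∪ F)
  unaware : ∀ φ ∈ F, ∀ p ∈ φ.prims, p ∈ Q → neg (Astar i (prim p)) ∈ F
  dichotomy : awareOfAll i x ∈ F ∧ Q = ∅ ∨ neg (awareOfAll i x) ∈ F ∧ Q.Infinite

variable {ℒ : Fragment} {L Q : Set Φ} {Γ : Set (Formula n Φ V)} {F : Finset (Formula n Φ V)}
  {φ : Formula n Φ V} {i : Fin n} {x y : V} {p : Φ}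

theorem IsWorld.notMem_prims_of_mem_known_union [Nonempty V] (h : ℒ.IsWorld L Γ)
    (hp : p ∉ awarePrims i Γ) (hpF : ∀ ψ ∈ F, p ∉ ψ.prims) : ∀ ψ ∈ known i Γ ∪ F, p ∉ ψ.prims :=
  fun ψ hψ => hψ.elim (fun hψ hpψ => hp ((h.known_subset_sentencesOver hψ).2 hpψ)) (hpF ψ)

namespace IsStage

theorem quant (hF : ℒ.IsStage i x Γ Q F) : ℒ.quant := by
  rcases hF.dichotomy with ⟨hm, -⟩ | ⟨hm, -⟩
  exacts [sentence_awareOfAll.1 (hF.subset hm).1,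
    sentence_awareOfAll.1 (sentence_neg.1 (hF.subset hm).1)]

section

variable [DecidableEq (Formula n Φ V)]

theorem insert (hF : ℒ.IsStage i x Γ Q F) (hφ : φ ∈ ℒ.sentencesOver (awarePrims i Γ ∪ Q))
    (hunaware : ∀ p ∈ φ.prims, p ∈ Q → neg (Astar i (prim p)) ∈ insert φ F)
    (hcon : ℒ.Consistent (insert φ (known i Γ ∪ F))) : ℒ.IsStage i x Γ Q (insert φ F) where
  subset := by
    rw [Finset.coe_insert]
    exact Set.insert_subset hφ hF.subset
  consistent := by rwa [Finset.coe_insert, Set.union_insert]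
  unaware := Finset.forall_mem_insert _ _ _ |>.2
    ⟨hunaware, fun ψ hψ p hp hpQ => Finset.mem_insert_of_mem (hF.unaware ψ hψ p hp hpQ)⟩
  dichotomy := hF.dichotomy.imp (.imp_left Finset.mem_insert_of_mem)
    (.imp_left Finset.mem_insert_of_mem)

theorem insert_unaware (hF : ℒ.IsStage i x Γ Q F) (h : ℒ.IsWorld L Γ)
    (hQ : Disjoint (awarePrims i Γ) Q) (hp : p ∈ Q) (hpF : ∀ ψ ∈ F, p ∉ ψ.prims) :
    ℒ.IsStage i x Γ Q (Insert.insert (neg (Astar i (prim p))) F) := by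
  have : Nonempty V := ⟨x⟩
  refine hF.insert ⟨by simp, by simpa [prims] using .inr hp⟩ (by simp [prims]) ?_
  by_contra hcon
  have hall : ℒ.Derives (known i Γ ∪ F) (awareOfAll i x) :=
    .all_of_instance hF.quant
      (h.notMem_prims_of_mem_known_union (hQ.notMem_of_mem_right hp) hpF) (by simp [prims])
      (by simpa using derives_of_not_consistent_neg hcon (by simp))
  rcases hF.dichotomy with ⟨-, rfl⟩ | ⟨hm, -⟩
  · exact hp
  · exact hF.consistent _ hall (.of_mem (.inr hm) (hF.subset hm).1)

end

theorem exists_unaware (hF : ℒ.IsStage i x Γ Q F) (h : ℒ.IsWorld L Γ)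
    (hQ : Disjoint (awarePrims i Γ) Q) {T : Set Φ} (hT : T.Finite) (hTQ : T ⊆ Q) :
    ∃ F', ℒ.IsStage i x Γ Q F' ∧ F ⊆ F' ∧ ∀ p ∈ T, neg (Astar i (prim p)) ∈ F' := by
  classical
  induction T, hT using Set.Finite.induction_on with
  | empty => exact ⟨F, hF, subset_rfl, by simp⟩
  | @insert p T _ _ ih =>
    rw [Set.insert_subset_iff] at hTQ
    obtain ⟨F', hF', hsub, hmem⟩ := ih hTQ.2
    by_cases hp : ∃ φ ∈ F', p ∈ φ.prims
    · obtain ⟨φ, hφ, hp⟩ := hp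
      exact ⟨F', hF', hsub, Set.forall_mem_insert.2 ⟨hF'.unaware φ hφ p hp hTQ.1, hmem⟩⟩
    · refine ⟨_, hF'.insert_unaware h hQ hTQ.1 (by simpa using hp),
        hsub.trans (Finset.subset_insert _ _), Set.forall_mem_insert.2
        ⟨Finset.mem_insert_self _ _, fun r hr => Finset.mem_insert_of_mem (hmem r hr)⟩⟩

theorem exists_decide (hF : ℒ.IsStage i x Γ Q F) (h : ℒ.IsWorld L Γ)
    (hQ : Disjoint (awarePrims i Γ) Q) (hφ : φ ∈ ℒ.sentencesOver (awarePrims i Γ ∪ Q)) :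
    ∃ F', ℒ.IsStage i x Γ Q F' ∧ F ⊆ F' ∧ (φ ∈ F' ∨ neg φ ∈ F') := by
  classical
  obtain ⟨F', hF', hsub, hmem⟩ :=
    hF.exists_unaware h hQ (φ.finite_prims.inter_of_left Q) Set.inter_subset_right
  have hunaware (ψ) : ∀ p ∈ φ.prims, p ∈ Q → neg (Astar i (prim p)) ∈ Insert.insert ψ F' :=
    fun p hp hpQ => Finset.mem_insert_of_mem (hmem p ⟨hp, hpQ⟩)
  have hsub' (ψ) : F ⊆ Insert.insert ψ F' := hsub.trans (Finset.subset_insert _ _)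
  rcases hF'.consistent.insert_or hφ.1 with hcon | hcon
  · exact ⟨_, hF'.insert hφ (hunaware φ) hcon, hsub' φ, .inl (Finset.mem_insert_self _ _)⟩
  · exact ⟨_, hF'.insert (neg_mem_sentencesOver.2 hφ) (hunaware (neg φ)) hcon, hsub' (neg φ),
      .inr (Finset.mem_insert_self _ _)⟩

theorem exists_aware_counterexample (hF : ℒ.IsStage i x Γ Q F)
    (hQ : Disjoint (awarePrims i Γ) Q) (hm : neg (all y φ) ∈ F) {θ : Formula n Φ V}
    (hθ : θ ∈ ℒ.range) (hθA : θ.prims ⊆ awarePrims i Γ)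
    (hcon : ℒ.Consistent (Insert.insert (neg (φ.substVar y θ)) (known i Γ ∪ F))) :
    ∃ F', ℒ.IsStage i x Γ Q F' ∧ F ⊆ F' ∧ neg (φ.substVar y θ) ∈ F' := by
  classical
  have hφθ := substVar_mem_sentencesOver (neg_mem_sentencesOver.1 (hF.subset hm)) hθ
    (hθA.trans Set.subset_union_left)
  refine ⟨_, hF.insert (neg_mem_sentencesOver.2 hφθ) (fun p hp hpQ => ?_) hcon,
    Finset.subset_insert _ _, Finset.mem_insert_self _ _⟩
  have hpφ := (prims_substVar_subset y φ θ hp).resolve_right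
    fun hpθ => hQ.notMem_of_mem_right hpQ (hθA hpθ)
  exact Finset.mem_insert_of_mem (hF.unaware _ hm p hpφ hpQ)

theorem exists_new_counterexample (hF : ℒ.IsStage i x Γ Q F) (h : ℒ.IsWorld L Γ)
    (hQ : Disjoint (awarePrims i Γ) Q) (hm : neg (all y φ) ∈ F) (hp : p ∈ Q)
    (hpF : ∀ ψ ∈ F, p ∉ ψ.prims)
    (himp : ℒ.Derives (known i Γ ∪ F) (imp (Astar i (prim p)) (φ.substVar y (prim p)))) :
    ∃ F', ℒ.IsStage i x Γ Q F' ∧ F ⊆ F' ∧ neg (φ.substVar y (prim p)) ∈ F' := by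
  classical
  have : Nonempty V := ⟨x⟩
  have hall := neg_mem_sentencesOver.1 (hF.subset hm)
  have hφp := substVar_mem_sentencesOver hall (prim_mem_range p) (Set.singleton_subset_iff.2
    (.inr hp))
  refine ⟨_, (hF.insert_unaware h hQ hp hpF).insert (neg_mem_sentencesOver.2 hφp)
    (fun r hr hrQ => ?_) ?_, (Finset.subset_insert _ _).trans (Finset.subset_insert _ _),
    Finset.mem_insert_self _ _⟩
  · rcases prims_substVar_subset y φ (prim p) hr with hr | rfl
    · exact Finset.mem_insert_of_mem (Finset.mem_insert_of_mem (hF.unaware _ hm r hr hrQ))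
    · exact Finset.mem_insert_of_mem (Finset.mem_insert_self _ _)
  · by_contra hcon
    have hd := derives_of_not_consistent_neg hcon hφp.1
    rw [Finset.coe_insert, Set.union_insert] at hd
    refine not_derives_substVar_of_neg_all_mem hF.consistent hall.1 (.inr hm)
      (h.notMem_prims_of_mem_known_union (hQ.notMem_of_mem_right hp) hpF)
      (himp.of_imp_of_neg_imp (hd.deduction (by simp)))

theorem exists_counterexample [Infinite V] (hF : ℒ.IsStage i x Γ Q F) (h : ℒ.IsWorld L Γ)
    (hQ : Disjoint (awarePrims i Γ) Q) (hco : (awarePrims i Γ ∪ Q)ᶜ.Infinite)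
    (hm : neg (all y φ) ∈ F) :
    ∃ F', ℒ.IsStage i x Γ Q F' ∧ F ⊆ F' ∧
      ∃ θ ∈ ℒ.range, θ.prims ⊆ awarePrims i Γ ∪ Q ∧ neg (φ.substVar y θ) ∈ F' := by
  have hs : ℒ.Sentence (all y φ) := (neg_mem_sentencesOver.1 (hF.subset hm)).1
  by_cases haware : ∃ θ ∈ ℒ.range, θ.prims ⊆ awarePrims i Γ ∧
      ℒ.Consistent (Insert.insert (neg (φ.substVar y θ)) (known i Γ ∪ F))
  · obtain ⟨θ, hθ, hθA, hcon⟩ := haware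
    obtain ⟨F', hF', hsub, hmem⟩ := hF.exists_aware_counterexample hQ hm hθ hθA hcon
    exact ⟨F', hF', hsub, θ, hθ, hθA.trans Set.subset_union_left, hmem⟩
  push Not at haware
  have himp {p : Φ} (hpF : ∀ ψ ∈ F, p ∉ ψ.prims) :
      ℒ.Derives (known i Γ ∪ F) (imp (Astar i (prim p)) (φ.substVar y (prim p))) :=
    h.derives_union_imp_substVar_prim (fun ψ hψ => (hF.subset hψ).1) hs
      (fun θ hθ hθA => derives_of_not_consistent_neg (haware θ hθ hθA) (hs.substVar hθ)) hpF
      (hpF (neg (all y φ)) hm)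
  rcases hF.dichotomy with ⟨hall, -⟩ | ⟨-, hinf⟩
  · obtain ⟨p, hp, hpF⟩ := exists_fresh_prim hco F
    have hA : ℒ.Derives (known i Γ ∪ F) (Astar i (prim p)) := by
      simpa using Derives.inst_all (.of_mem (.inr hall) (hF.subset hall).1) (prim_mem_range p)
    exact (not_derives_substVar_of_neg_all_mem hF.consistent hs (.inr hm)
      (h.notMem_prims_of_mem_known_union (fun hpA => hp (.inl hpA)) hpF) ((himp hpF).mp hA)).elim
  · obtain ⟨p, hp, hpF⟩ := exists_fresh_prim hinf F
    obtain ⟨F', hF', hsub, hmem⟩ := hF.exists_new_counterexample h hQ hm hp hpF (himp hpF)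
    exact ⟨F', hF', hsub, prim p, prim_mem_range p, Set.singleton_subset_iff.2 (.inr hp), hmem⟩

theorem isConsistencyProperty [Infinite V] (h : ℒ.IsWorld L Γ)
    (hQ : Disjoint (awarePrims i Γ) Q) (hco : (awarePrims i Γ ∪ Q)ᶜ.Infinite) :
    ℒ.IsConsistencyProperty (awarePrims i Γ ∪ Q) (known i Γ) {F | ℒ.IsStage i x Γ Q F} where
  base_subset _ hφ :=
    (h.known_subset_sentencesOver hφ).imp_right fun hA => hA.trans Set.subset_union_left
  subset _ hF := hF.subset
  consistent _ hF := hF.consistent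
  decide _ hF _ hφ := hF.exists_decide h hQ hφ
  counterexample _ hF _ _ hm := hF.exists_counterexample h hQ hco hm

theorem exists_accessible [Countable Φ] [Countable V] [Infinite V]
    (hF : ℒ.IsStage i x Γ Q F) (h : ℒ.IsWorld L Γ) (hQ : Disjoint (awarePrims i Γ) Q)
    (hne : (awarePrims i Γ ∪ Q).Nonempty) (hco : (awarePrims i Γ ∪ Q)ᶜ.Infinite) :
    ∃ Γ', ℒ.IsWorld (awarePrims i Γ ∪ Q) Γ' ∧ (∀ φ, K i φ ∈ Γ ↔ K i φ ∈ Γ') ∧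
      (F : Set (Formula n Φ V)) ⊆ Γ' := by
  obtain ⟨Γ', hΓ', hknown, hFΓ', hstage⟩ :=
    (isConsistencyProperty (x := x) h hQ hco).exists_isWorld hF hne hco
  refine ⟨Γ', hΓ', h.K_mem_iff_of_known_subset hΓ' hknown fun p hp => ?_, hFΓ'⟩
  refine (hΓ'.awarePrims_subset hp).resolve_right fun hpQ => ?_
  obtain ⟨F', hF', hmem⟩ := hstage _ hp
  have hneg := hF'.unaware _ hmem p (by simp [prims]) hpQ
  exact hF'.consistent _ (.of_mem (.inr hmem) (by simp)) (.of_mem (.inr hneg) (by simp))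

end IsStage

end Fragment

open Classical in
/-- A structure with two worlds, each of which is accessible from the other and only one of which
has the primitive proposition `r` in its language, so that `A_i^* r` is not valid. -/
noncomputable abbrev partialLang (n : ℕ) (V : Type u) [Nontrivial Φ] (r : Φ) :
    ExtStructure n Φ V where
  World := ULift Bool
  lang s := {p | s.down ∨ p ≠ r}
  lang_nonempty _ := (exists_ne r).imp fun _ => .inr
  val _ _ := false
  rel _ _ _ := True
  aware _ _ := {φ | φ.IsSentence ∧ φ.prims = ∅}
  aware_sentence _ _ _ h := h.1
  aware_lang _ _ _ h := h.2.subset.trans (Set.empty_subset _)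

theorem isNrte_partialLang [Nontrivial Φ] (r : Φ) : (partialLang n V r).IsNrte where
  agpp i s φ hφ := by simp [hφ, prims, Set.eq_empty_iff_forall_notMem]
  ka _ _ _ _ := rfl
  refl _ _ := trivial
  trans _ _ _ _ _ _ := trivial
  eucl _ _ _ _ _ _ := trivial

namespace Fragment

variable {ℒ : Fragment} {L : Set Φ} {Γ B : Set (Formula n Φ V)} {φ : Formula n Φ V} {i : Fin n}

theorem not_proves_Astar_prim [Infinite Φ] (i : Fin n) (r : Φ) :
    ¬ ℒ.Proves (Astar i (prim r : Formula n Φ V)) := by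
  intro h
  have hr : (prim r : Formula n Φ V).prims ⊆ (partialLang n V r).lang ⟨true⟩ :=
    fun _ _ => .inl rfl
  have hsat := h.valid _ (isNrte_partialLang r) ⟨true⟩ (by rwa [prims_Astar])
  simpa [partialLang, prims] using (sat_Astar hr).1 hsat ⟨false⟩ trivial

namespace IsWorld

theorem awareOfNone_mem (h : ℒ.IsWorld L Γ) (hq : ℒ.quant)
    (hA : awarePrims i Γ = ∅) (x : V) : awareOfNone i x ∈ Γ := by
  have : Nonempty V := ⟨x⟩
  rw [awareOfNone, h.all_mem_iff ⟨sentence_awareOfNone.2 hq,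
    (prims_awareOfNone i x).subset.trans (Set.empty_subset _)⟩]
  intro θ hθ hθL
  have hs := sentence_of_mem_range hθ
  rw [substVar_neg, substVar_Astar, substVar_var_self,
    h.neg_mem_iff ⟨sentence_Astar.2 hs, by rwa [prims_Astar]⟩, h.Astar_mem_iff hs, hA,
    Set.subset_empty_iff]
  exact hθ.1.prims_nonempty.ne_empty

/-- By FA^*, an agent that is aware of nothing knows it, which contradicts `∀x A_i^* x` at an
arbitrary primitive proposition. -/
theorem awarePrims_nonempty (h : ℒ.IsWorld L Γ) (hq : ℒ.quant) {x : V}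
    (hB : known i Γ ⊆ B) (hcon : ℒ.Consistent (insert (awareOfAll i x) B)) :
    (awarePrims i Γ).Nonempty := by
  by_contra hA
  obtain ⟨p, -⟩ := h.nonempty
  have hnone := h.derives (h.awareOfNone_mem hq (Set.not_nonempty_iff_eq_empty.1 hA) x)
  have hFA : ℒ.Proves (imp (awareOfNone i x : Formula n Φ V) (K i (awareOfNone i x))) :=
    .of_schemesAllK hq (.inr ⟨i, x, rfl⟩) (by simp [hq])
  have hmem : K i (awareOfNone i x) ∈ Γ := h.mem_of_derives (hFA.derives.mp hnone)
    ((prims_awareOfNone i x).subset.trans (Set.empty_subset _))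
  refine hcon (Astar i (prim p)) ?_ ?_
  · simpa using Derives.inst_all (.of_mem (.inl rfl) (sentence_awareOfAll.2 hq))
      (prim_mem_range p)
  · simpa using Derives.inst_all (.of_mem (.inr (hB hmem)) (sentence_awareOfNone.2 hq))
      (prim_mem_range p)

end IsWorld

theorem IsStage.of_subset_sentencesOver {Q : Set Φ} {F : Finset (Formula n Φ V)} {x : V}
    (hQ : Disjoint (awarePrims i Γ) Q)
    (hF : (F : Set (Formula n Φ V)) ⊆ ℒ.sentencesOver (awarePrims i Γ))
    (hcon : ℒ.Consistent (known i Γ ∪ F))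
    (hd : awareOfAll i x ∈ F ∧ Q = ∅ ∨ neg (awareOfAll i x) ∈ F ∧ Q.Infinite) :
    ℒ.IsStage i x Γ Q F where
  subset _ hφ := (hF hφ).imp_right fun h => h.trans Set.subset_union_left
  consistent := hcon
  unaware _ hφ _ hp hpQ := (hQ.notMem_of_mem_right hpQ ((hF hφ).2 hp)).elim
  dichotomy := hd

/-- The sentences in `F` belong to a world that `i` considers possible in `Γ`. The primitive
propositions of `L` that `i` is unaware of are undefined there. -/
def HoldsAtAccessible (ℒ : Fragment) (i : Fin n) (L : Set Φ) (Γ : Set (Formula n Φ V))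
    (F : Finset (Formula n Φ V)) : Prop :=
  ∃ L' Γ', ℒ.IsWorld L' Γ' ∧ (∀ φ, K i φ ∈ Γ ↔ K i φ ∈ Γ') ∧ (F : Set (Formula n Φ V)) ⊆ Γ' ∧
    L' ⊆ awarePrims i Γ ∪ Lᶜ

namespace IsWorld

section Accessible

variable [Countable Φ] [Countable V] {F : Finset (Formula n Φ V)}

theorem holdsAtAccessible_of_insert [Infinite V] (h : ℒ.IsWorld L Γ) {Q : Set Φ} {x : V}
    (hQ : Q ⊆ Lᶜ) (hdiff : (Lᶜ \ Q).Infinite) (hne : (awarePrims i Γ ∪ Q).Nonempty)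
    (hφ : φ ∈ ℒ.sentencesOver (awarePrims i Γ))
    (hF : (F : Set (Formula n Φ V)) ⊆ ℒ.sentencesOver (awarePrims i Γ))
    (hcon : ℒ.Consistent (insert φ (known i Γ ∪ F)))
    (hd : awareOfAll i x = φ ∧ Q = ∅ ∨ neg (awareOfAll i x) = φ ∧ Q.Infinite) :
    ℒ.HoldsAtAccessible i L Γ F := by
  classical
  have hdisj : Disjoint (awarePrims i Γ) Q :=
    (Set.disjoint_compl_right_iff_subset.2 h.awarePrims_subset).mono_right hQ
  have hstage : ℒ.IsStage i x Γ Q (insert φ F) := by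
    refine .of_subset_sentencesOver hdisj ?_ ?_ ?_
    · rw [Finset.coe_insert]
      exact Set.insert_subset hφ hF
    · rwa [Finset.coe_insert, Set.union_insert]
    · exact hd.imp (.imp_left fun he => Finset.mem_insert.2 (.inl he))
        (.imp_left fun he => Finset.mem_insert.2 (.inl he))
  obtain ⟨Γ', hΓ', hK, hm⟩ := hstage.exists_accessible h hdisj hne
    (hdiff.mono fun p hp => not_or.2 ⟨fun hpA => hp.1 (h.awarePrims_subset hpA), hp.2⟩)
  rw [Finset.coe_insert, Set.insert_subset_iff] at hm
  exact ⟨_, Γ', hΓ', hK, hm.2, Set.union_subset_union_right _ hQ⟩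

theorem holdsAtAccessible_of_quant [Infinite V] (h : ℒ.IsWorld L Γ) (hq : ℒ.quant)
    (hF : (F : Set (Formula n Φ V)) ⊆ ℒ.sentencesOver (awarePrims i Γ))
    (hcon : ℒ.Consistent (known i Γ ∪ F)) : ℒ.HoldsAtAccessible i L Γ F := by
  obtain ⟨x⟩ : Nonempty V := inferInstance
  have hall : awareOfAll i x ∈ ℒ.sentencesOver (awarePrims i Γ) := ⟨by simpa, by simp⟩
  rcases hcon.insert_or hall.1 with hc | hc
  · exact h.holdsAtAccessible_of_insert (Set.empty_subset _) (by simpa using h.infinite_compl)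
      ((h.awarePrims_nonempty hq Set.subset_union_left hc).mono Set.subset_union_left) hall hF
      hc (.inl ⟨rfl, rfl⟩)
  · obtain ⟨Q, hQ, hinf, hdiff⟩ := exists_infinite_subset_diff h.infinite_compl
    exact h.holdsAtAccessible_of_insert hQ hdiff (hinf.nonempty.mono Set.subset_union_right)
      (neg_mem_sentencesOver.2 hall) hF hc (.inr ⟨rfl, hinf⟩)

theorem holdsAtAccessible_of_not_quant [Nonempty V] (h : ℒ.IsWorld L Γ) (hq : ¬ ℒ.quant)
    (hF : (F : Set (Formula n Φ V)) ⊆ ℒ.sentencesOver (awarePrims i Γ))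
    (hcon : ℒ.Consistent (known i Γ ∪ F)) : ℒ.HoldsAtAccessible i L Γ F := by
  have hsub : known i Γ ∪ F ⊆ ℒ.sentencesOver (awarePrims i Γ) :=
    Set.union_subset h.known_subset_sentencesOver hF
  by_cases hne : (awarePrims i Γ).Nonempty
  · obtain ⟨Γ', hΓ', hm⟩ := exists_isWorld_of_consistent hne
      (h.infinite_compl.mono (Set.compl_subset_compl.2 h.awarePrims_subset)) hsub hcon
      fun hq' => (hq hq').elim
    rw [Set.union_subset_iff] at hm
    exact ⟨_, Γ', hΓ', h.K_mem_iff_of_known_subset hΓ' hm.1 hΓ'.awarePrims_subset, hm.2,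
      Set.subset_union_left⟩
  · rw [Set.not_nonempty_iff_eq_empty] at hne
    have hempty : known i Γ ∪ F = ∅ := Set.eq_empty_of_forall_notMem fun φ hφ =>
      (((hsub hφ).1.2.2 hq).prims_nonempty.mono (hsub hφ).2).ne_empty hne
    obtain ⟨hknown, hF⟩ := Set.union_empty_iff.1 hempty
    obtain ⟨r, hr⟩ := h.infinite_compl.nonempty
    have : Infinite Φ := Set.infinite_univ_iff.1 (h.infinite_compl.mono (Set.subset_univ _))
    -- `i` knows nothing, and `¬A_i^* r` ensures that it knows nothing in the new world either.
    have hs : neg (Astar i (prim r)) ∈ ℒ.sentencesOver (V := V) {r} := by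
      simp [sentencesOver, prims]
    obtain ⟨Γ', hΓ', hm⟩ := exists_isWorld_of_consistent (Set.singleton_nonempty r)
      (Set.finite_singleton r).infinite_compl (Set.singleton_subset_iff.2 hs)
      (consistent_singleton_neg (sentence_neg.1 hs.1) (not_proves_Astar_prim i r))
      fun hq' => (hq hq').elim
    refine ⟨_, Γ', hΓ', h.K_mem_iff_of_known_subset hΓ' (hknown ▸ Set.empty_subset _)
      fun p hp => ?_, hF ▸ Set.empty_subset _, Set.singleton_subset_iff.2 (.inr hr)⟩
    obtain rfl := hΓ'.awarePrims_subset hp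
    exact ((hΓ'.neg_mem_iff (neg_mem_sentencesOver.1 hs)).1 (hm rfl) hp).elim

end Accessible

theorem exists_accessible [Countable Φ] [Countable V] [Infinite V]
    (h : ℒ.IsWorld L Γ) (hφ : φ ∈ ℒ.sentencesOver L) (hK : K i φ ∉ Γ) :
    ∃ L' Γ', ℒ.IsWorld L' Γ' ∧ (∀ ψ, K i ψ ∈ Γ ↔ K i ψ ∈ Γ') ∧ φ ∉ Γ' := by
  have extend {F : Finset (Formula n Φ V)}
      (hF : (F : Set (Formula n Φ V)) ⊆ ℒ.sentencesOver (awarePrims i Γ))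
      (hcon : ℒ.Consistent (known i Γ ∪ F)) : ℒ.HoldsAtAccessible i L Γ F :=
    (em ℒ.quant).elim (h.holdsAtAccessible_of_quant · hF hcon)
      (h.holdsAtAccessible_of_not_quant · hF hcon)
  by_cases hA : φ.prims ⊆ awarePrims i Γ
  · have hcon := h.consistent_insert_neg_known ⟨hφ.1, hA⟩ hK
    obtain ⟨L', Γ', hΓ', hiff, hm, -⟩ := extend (F := {neg φ})
      (by simpa using ⟨hφ.1, hA⟩) (by simpa using hcon)
    rw [Finset.coe_singleton, Set.singleton_subset_iff] at hm
    exact ⟨L', Γ', hΓ', hiff, (hΓ'.neg_mem_iff (neg_mem_sentencesOver.1 (hΓ'.subset hm))).1 hm⟩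
  · obtain ⟨p, hpφ, hpA⟩ := Set.not_subset.1 hA
    obtain ⟨L', Γ', hΓ', hiff, -, hL'⟩ := extend (F := ∅) (by simp)
      (by simpa using h.consistent_known)
    refine ⟨L', Γ', hΓ', hiff, fun hm => ?_⟩
    exact (hL' (hΓ'.prims_subset hm hpφ)).elim hpA fun hpL => hpL (hφ.2 hpφ)

end IsWorld

end Fragment

/-! ### The canonical structure -/

namespace Fragment

/-- The worlds of the canonical structure. -/
structure CanonicalWorld (ℒ : Fragment) (n : ℕ) (Φ V : Type u) : Type u where
  /-- The primitive propositions of the language of the world. -/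
  lang : Set Φ
  /-- The sentences that are true at the world. -/
  truths : Set (Formula n Φ V)
  isWorld : ℒ.IsWorld lang truths

open Classical in
/-- The canonical structure. Two worlds are related if the agent knows the same in both. -/
noncomputable abbrev canonical (ℒ : Fragment) (n : ℕ) (Φ V : Type u) : ExtStructure n Φ V where
  World := ℒ.CanonicalWorld n Φ V
  lang s := s.lang
  lang_nonempty s := s.isWorld.nonempty
  val s p := decide (prim p ∈ s.truths)
  rel i s t := ∀ φ, K i φ ∈ s.truths ↔ K i φ ∈ t.truths
  aware i s := {φ | φ.IsSentence ∧ ∀ p ∈ φ.prims, A i (prim p) ∈ s.truths}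
  aware_sentence _ _ _ h := h.1
  aware_lang _ s _ h p hp := s.isWorld.prims_subset (h.2 p hp) rfl

variable {ℒ : Fragment} {s t : ℒ.CanonicalWorld n Φ V} {i : Fin n} {φ : Formula n Φ V}

theorem A_mem_truths_of_rel (hst : (ℒ.canonical n Φ V).rel i s t) (h : A i φ ∈ s.truths) :
    A i φ ∈ t.truths :=
  t.isWorld.of_K_mem ((hst _).1 (s.isWorld.K_A_mem h))

theorem isNrte_canonical : (ℒ.canonical n Φ V).IsNrte where
  agpp _ _ _ hφ :=
    ⟨fun h p hp => ⟨rfl, fun _ hq => Set.mem_singleton_iff.1 hq ▸ h.2 p hp⟩,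
      fun h => ⟨hφ, fun p hp => (h p hp).2 p rfl⟩⟩
  ka _ _ _ hst := Set.ext fun _ => and_congr_right fun _ => forall₂_congr fun _ _ =>
    ⟨A_mem_truths_of_rel hst, A_mem_truths_of_rel fun ψ => (hst ψ).symm⟩
  refl _ _ _ := Iff.rfl
  trans _ _ _ _ hst htu φ := (hst φ).trans (htu φ)
  eucl _ _ _ _ hst hsu φ := (hst φ).symm.trans (hsu φ)

theorem mem_aware_canonical_iff [Nonempty V] (hA : ℒ.Sentence (A i φ)) :
    φ ∈ (ℒ.canonical n Φ V).aware i s ↔ A i φ ∈ s.truths := by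
  rw [s.isWorld.A_mem_iff hA]
  exact and_iff_right (sentence_A.1 hA).2.1

theorem sat_canonical_iff_of_prims_subset
    (h : φ.prims ⊆ s.lang → ((ℒ.canonical n Φ V).Sat ℒ.range s φ ↔ φ ∈ s.truths)) :
    (ℒ.canonical n Φ V).Sat ℒ.range s φ ↔ φ ∈ s.truths :=
  ⟨fun hsat => (h hsat.prims_subset).1 hsat, fun hm => (h (s.isWorld.prims_subset hm)).2 hm⟩

section

variable [Countable Φ] [Countable V] [Infinite V]

theorem K_mem_truths_iff (hφ : φ ∈ ℒ.sentencesOver s.lang) :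
    K i φ ∈ s.truths ↔ ∀ t, (ℒ.canonical n Φ V).rel i s t → φ ∈ t.truths := by
  refine ⟨fun h t hst => t.isWorld.of_K_mem ((hst φ).1 h), fun h => by_contra fun hK => ?_⟩
  obtain ⟨L, Γ, hΓ, hrel, hm⟩ := s.isWorld.exists_accessible hφ hK
  exact hm (h ⟨L, Γ, hΓ⟩ hrel)

theorem sat_canonical_K_iff (hφ : φ ∈ ℒ.sentencesOver s.lang)
    (h : ∀ t : ℒ.CanonicalWorld n Φ V, φ ∈ ℒ.sentencesOver t.lang →
      ((ℒ.canonical n Φ V).Sat ℒ.range t φ ↔ φ ∈ t.truths)) :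
    (ℒ.canonical n Φ V).Sat ℒ.range s (K i φ) ↔ K i φ ∈ s.truths := by
  rw [sat_K hφ.2, K_mem_truths_iff hφ]
  exact forall₂_congr fun t _ => sat_canonical_iff_of_prims_subset fun hL => h t ⟨hφ.1, hL⟩

theorem sat_canonical_iff (hφ : φ ∈ ℒ.sentencesOver s.lang) :
    (ℒ.canonical n Φ V).Sat ℒ.range s φ ↔ φ ∈ s.truths := by
  induction φ using instanceInduction generalizing s with
  | prim p =>
    classical
    rw [Sat]
    exact (and_iff_right (hφ.2 rfl)).trans decide_eq_true_iff
  | var x => exact (not_sentence_var hφ.1).elim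
  | neg φ ih =>
    rw [neg_mem_sentencesOver] at hφ
    rw [sat_neg hφ.2, ih hφ, s.isWorld.neg_mem_iff hφ]
  | and φ ψ ih₁ ih₂ =>
    obtain ⟨hsφ, hsψ⟩ := sentence_and.1 hφ.1
    obtain ⟨hLφ, hLψ⟩ := Set.union_subset_iff.1 hφ.2
    rw [sat_and, ih₁ ⟨hsφ, hLφ⟩, ih₂ ⟨hsψ, hLψ⟩, s.isWorld.and_mem_iff]
  | K i φ ih => exact sat_canonical_K_iff ⟨sentence_K.1 hφ.1, hφ.2⟩ fun _ => ih
  | A i φ => rw [sat_A, mem_aware_canonical_iff hφ.1]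
  | X i φ ih =>
    have hX := sentence_X.1 hφ.1
    rw [sat_X, sat_A, mem_aware_canonical_iff (sentence_A.2 hX),
      sat_canonical_K_iff ⟨hX.2, hφ.2⟩ fun _ => ih, s.isWorld.X_mem_iff hφ, and_comm]
  | all x φ ih =>
    rw [sat_all hφ.2, s.isWorld.all_mem_iff hφ]
    have inst (θ) (hθ : θ ∈ ℒ.range) (hL : θ.prims ⊆ s.lang) :=
      ih θ hθ.1 (substVar_mem_sentencesOver hφ hθ hL)
    exact ⟨fun h θ hθ hL => (inst θ hθ hL).1 (h θ hθ.1 hθ hL),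
      fun h θ _ hθ hL => (inst θ hθ hL).2 (h θ hθ hL)⟩

theorem proves_iff_valid [Infinite Φ] (hφ : ℒ.Sentence φ) :
    ℒ.Proves φ ↔ Valid ℒ.range φ := by
  refine ⟨Proves.valid, fun hvalid => by_contra fun hn => ?_⟩
  obtain ⟨L, Γ, hΓ, hL, hm⟩ := exists_isWorld_of_not_proves hφ hn
  exact hm ((sat_canonical_iff (s := ⟨L, Γ, hΓ⟩) ⟨hφ, hL⟩).1 (hvalid _ isNrte_canonical _ hL))

end

theorem schemeInstances_eq_schemesAllKXA :
    schemeInstances { kOnly := False, quant := True } = schemesAllKXA n Φ V ∩ LAllKXA n Φ V := by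
  ext φ
  simp only [schemeInstances, Sentence, schemesAllKXA, schemesAllK, LAllKXA, Set.mem_ofPred_eq,
    Set.mem_inter_iff, Set.mem_union]
  tauto

theorem schemeInstances_eq_schemesAllK :
    schemeInstances { kOnly := True, quant := True } = schemesAllK n Φ V ∩ LAllK n Φ V := by
  ext φ
  simp only [schemeInstances, Sentence, schemesAllK, LAllK, Set.mem_ofPred_eq, Set.mem_inter_iff,
    Set.mem_union]
  tauto

theorem schemeInstances_eq_schemesK :
    schemeInstances { kOnly := True, quant := False } = schemesK n Φ V ∩ LK n Φ V := by
  ext φ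
  have : φ.QuantFree → φ.IsSentence := QuantFree.free_eq_empty
  simp only [schemeInstances, Sentence, LK, Set.mem_ofPred_eq, Set.mem_inter_iff]
  tauto

theorem range_eq_LKXA (quant : Prop) : range { kOnly := False, quant } = LKXA n Φ V := by
  ext φ
  simp [range, LKXA]

theorem range_eq_LK (quant : Prop) : range { kOnly := True, quant } = LK n Φ V := by
  ext φ
  simp [range, LK]

end Fragment

end Awareness

theorem mainTheorem2 {n : ℕ} {Φ V : Type u} [Countable Φ] [Infinite Φ] [Countable V] [Infinite V] :
    (∀ φ ∈ Awareness.LAllKXA n Φ V,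
      Awareness.ProvableAllKXA φ ↔ Awareness.Valid (Awareness.LKXA n Φ V) φ) ∧
    (∀ φ ∈ Awareness.LAllK n Φ V,
      Awareness.ProvableAllK φ ↔ Awareness.Valid (Awareness.LK n Φ V) φ) ∧
    (∀ φ ∈ Awareness.LK n Φ V,
      Awareness.ProvableK φ ↔ Awareness.Valid (Awareness.LK n Φ V) φ) := by
  refine ⟨fun φ hφ => ?_, fun φ hφ => ?_, fun φ hφ => ?_⟩
  · rw [Awareness.ProvableAllKXA, ← Awareness.Fragment.schemeInstances_eq_schemesAllKXA,
      ← Awareness.Fragment.range_eq_LKXA True]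
    exact Awareness.Fragment.proves_iff_valid ⟨hφ, False.elim, fun h => (h trivial).elim⟩
  · rw [Awareness.ProvableAllK, ← Awareness.Fragment.schemeInstances_eq_schemesAllK,
      ← Awareness.Fragment.range_eq_LK True]
    exact Awareness.Fragment.proves_iff_valid ⟨hφ.1, fun _ => hφ.2, fun h => (h trivial).elim⟩
  · rw [Awareness.ProvableK, ← Awareness.Fragment.schemeInstances_eq_schemesK,
      ← Awareness.Fragment.range_eq_LK False]
    exact Awareness.Fragment.proves_iff_valid ⟨hφ.1.free_eq_empty, fun _ => hφ.2, fun _ => hφ.1⟩
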